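/- **Setting.** A plant $\dot x_p=f_p(x_p,\hat u,w)$, $y=g_p(x_p)$ and a controller $\dot x_c=f_c(x_c,\hat y)$, $u=g_c(x_c)$ are given, with $f_p,f_c$ continuous, $g_p,g_c$ continuously differentiable, all zero at zero; static controllers $\hat u=\kappa(\hat y)$ with only $y$ transmitted are included. The coordinates of $v=(y,u)$ are distributed over $N$ channels, $v_i=g_{v_i}(x)\in\mathbb R^{n_{v,i}}$, $x=(x_p,x_c)$. Let $e_i=\hat v_i-v_i$, and write $\dot x=f(x,e,w)$ for the closed loop ($\hat y=y+e_y$, $\hat u=u+e_u$) and $f_{v_i}=\frac{\partial g_{v_i}}{\partial x}f$. Channel $i$ has a scheduling protocol $h_{v_i}(k,\cdot)$, $k\in\mathbb Z_{\ge0}$, constants $0<T_m^i\le T_M^i$ and a maximum allowable delay number in sampling $D_i\in\mathbb Z_{\ge0}$. The state is $q=(x,e,\theta,\tilde v,\hat\tau,\bar k,\tilde k,l,\hat m,\eta)$. The state space $\mathcal X$ is given by $\bar k_i,\tilde k_i\in\mathbb Z_{\ge0}$, $l_i\in\{0,\dots,D_i+1\}$, $\theta_i=(\theta_{i,1},\dots,\theta_{i,D_i+1})$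 with $\theta_{i,j}=0$ for $j>l_i$ (call such $(l_i,\theta_i)$ admissible), $\hat\tau_i\ge0$, $\hat m_i\in\{-1,1\}$, $\eta_i\ge0$. On $\mathcal C=\{q\in\mathcal X:\hat\tau_i\in[0,T_M^i]\ \forall i\}$ the state flows by $\dot x=f(x,e,w)$, $\dot e_i=-f_{v_i}$, $\dot{\hat\tau}_i=1$, $\dot\eta_i=f_\eta^i(q)$, the other components being constant. Channel $i$ may jump on $\mathcal D_i=\{q\in\mathcal X:\hat\tau_i\in[T_m^i,T_M^i]\}$, the components not listed being unchanged and the new state again in $\mathcal X$ (with $\xi_m(p)=-1$ if $m=p$ and $1$ otherwise, and $h_{v_i}=h_{v_i}(\bar k_i,e_i+\sum_{j\le l_i}\theta_{i,j})$): * transmission, if $\hat m_i=1$, $g_s^i(q)\le0$: $\theta_i^+=(\theta_{i,1},\dots,\theta_{i,l_i},\,h_{v_i}-e_i-\sum_{j\le l_i}\theta_{i,j},\,0,\dots,0)$, $\tilde v_i^+=v_i$, $\hat\tau_i^+=0$, $\bar k_i^+=\bar k_i+1$, $l_i^+=l_i+1$, $\hat m_i^+\in\{-1,\xi_{D_i}(l_i)\}$,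 $\eta_i^+=g_t^i(q)$; * sampling only, if $\hat m_i=1$, $g_s^i(q)\ge0$: $\tilde v_i^+=v_i$, $\hat\tau_i^+=0$, $\eta_i^+=g_s^i(q)$; * update, if $\hat m_i=-1$: $e_i^+=e_i+\theta_{i,1}$, $\theta_i^+=(\theta_{i,2},\dots,\theta_{i,D_i+1},0)$, $\tilde k_i^+=\tilde k_i+1$, $l_i^+=l_i-1$, $\hat m_i^+\in\{-\xi_1(l_i),1\}$. Here $f_\eta^i\ge0$ whenever $\eta_i=0$, and $g_t^i\ge0$. Solutions start in $\mathcal C\cup\bigcup_i\mathcal D_i$ and stay in $\mathcal X$. **Assumption on the errors.** For each $i$ there are $\tilde W_i(\bar k_i,l_i,\theta_i,e_i)\ge0$, locally Lipschitz in $(\theta_i,e_i)$, functions $\underline\beta_{\tilde W_i},\bar\beta_{\tilde W_i}\in\mathcal K_\infty$, continuous $H_{l,i}(x,e,w)\ge0$, constants $L_{l,i}>0$ ($0\le l\le D_i+1$) and $\tilde\lambda_i\in(0,1)$ such that, for admissible $(l_i,\theta_i)$ and all $\bar k_i,e_i$: $\underline\beta_{\tilde W_i}(\|(e_i,\theta_i)\|)\le\tilde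 W_i\le\bar\beta_{\tilde W_i}(\|(e_i,\theta_i)\|)$; if $l_i\le D_i$, replacing $(\bar k_i,l_i,\theta_i)$ by its value after a transmission turns $\tilde W_i$ into at most $\tilde\lambda_i\tilde W_i$; if $l_i\ge1$, replacing $(l_i,\theta_i,e_i)$ by its value after an update does not increase $\tilde W_i$; and $\langle\partial\tilde W_i/\partial e_i,-f_{v_i}\rangle\le L_{l_i,i}\tilde W_i+H_{l_i,i}(x,e,w)$ for almost all $e_i$. **Assumption on plant and controller.** There are locally Lipschitz $\tilde V(x),\tilde\delta_i(v_i),\hat\delta_i(v_i)\ge0$ with $\tilde\delta_i(0)=0$, functions $\underline\beta_{\tilde V},\bar\beta_{\tilde V},\underline\beta_{\tilde\delta_i},\bar\beta_{\tilde\delta_i},\alpha_{\tilde V},\alpha_w,\sigma_{l,i}\in\mathcal K_\infty$, continuous $\tilde J_i(x,e,w)\ge0$, and $\gamma_{l,i}>0$, $\epsilon_{l,i}\ge0$ ($0\le l\le D_i+1$) with $\underline\beta_{\tilde V}(\|x\|)\le\tilde V(x)\le\bar\beta_{\tilde V}(\|x\|)$, $\underline\beta_{\tilde\delta_i}(\|v_i\|)\le\tilde\delta_i(v_i)\le\bar\beta_{\tilde\delta_i}(\|v_i\|)$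 and, for almost all $x$, all $e,w$, all $\bar k_i$ and all admissible $(l_i,\theta_i)$, with $v_i=g_{v_i}(x)$, $\hat v_i=v_i+e_i$, $$\langle\nabla\tilde V,f\rangle\le-\alpha_{\tilde V}(\|x\|)+\sum_{i=1}^N\big(\gamma_{l_i,i}^2\tilde W_i^2-\tilde\delta_i(v_i)-\sigma_{l_i,i}(\tilde W_i)-(1+\epsilon_{l_i,i})H_{l_i,i}^2-\hat\delta_i(\hat v_i)-(1+\epsilon_{l_i,i})\tilde J_i\big)+\alpha_w(\|w\|),$$ and the derivative of $x\mapsto\tilde\delta_i(g_{v_i}(x))$ along $f$ (that is, $\langle\nabla\tilde\delta_i(v_i),f_{v_i}\rangle$) is at most $H_{l,i}^2+\tilde J_i$ for all $i$ and $0\le l\le D_i+1$. **Theorem.** Under these assumptions, let $\phi_{l,i}$ ($0\le l\le D_i+1$) solve $\dot\phi_{l,i}=-2L_{l,i}\phi_{l,i}-\gamma_{l,i}(\phi_{l,i}^2+1)$ on $[0,T_M^i]$, $\phi_{l,i}(0)>0$, and let $\varpi_i(\tau)=1-\frac{1-\pi_i}{T_M^i}\tau$ with $\pi_i\in(0,1)$.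 Suppose that, for every $i$, 1. $\gamma_{l,i}\phi_{l,i}(T_M^i)\ge\tilde\lambda_i^2\gamma_{l+1,i}\phi_{l+1,i}(0)$ for $0\le l\le D_i$, and $\gamma_{l-1,i}\phi_{l-1,i}(\tau)\le\gamma_{l,i}\phi_{l,i}(\tau)$ for $\tau\in[0,T_M^i]$, $1\le l\le D_i+1$; 2. with constants $a_i>0$, $\varepsilon_i\in(0,1)$, $\underline\phi_i>0$ such that $\underline\phi_i\le\phi_{l,i}$ on $[0,T_M^i]$ for all $l$, $0\le\bar\rho_i\le\min_l\epsilon_{l,i}$, $0\le\hat\rho_i\le\frac12\min\{1,\underline\phi_i/\max_l\gamma_{l,i}\}$ and $\tilde\rho_i=\min\{\bar\rho_i(1-\pi_i)/T_M^i,\pi_i/2\}$: $$f_\eta^i(q)\le-a_i\eta_i+\hat\delta_i(\hat v_i)+(1-\varepsilon_i)\tilde\rho_i\tilde\delta_i(\tilde v_i)\quad(q\in\mathcal C),$$ and, with $R_i=\eta_i-\bar\rho_i\tilde\delta_i(v_i)+\bar\rho_i\max\{\tilde\delta_i(v_i),\varpi_i(\hat\tau_i)\tilde\delta_i(\tilde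 v_i)\}+\max\{\gamma_{l_i,i}\phi_{l_i,i}(\hat\tau_i)\tilde W_i^2,\hat\rho_i\tilde\delta_i(v_i)\}$, $$g_t^i(q)\le R_i-\max\{\gamma_{l_i+1,i}\phi_{l_i+1,i}(0)\tilde\lambda_i^2\tilde W_i^2,\hat\rho_i\tilde\delta_i(v_i)\}\quad(q\in\mathcal D_i,\ l_i\le D_i),$$ $$g_s^i(q)\le R_i-\max\{\gamma_{l_i,i}\phi_{l_i,i}(0)\tilde W_i^2,\hat\rho_i\tilde\delta_i(v_i)\}\quad(q\in\mathcal D_i).$$ Then the set $\mathcal S=\{q\in\mathcal X:x=0,\ e=0,\ \eta=0\}$ is input-to-state stable with respect to $w$: there are $\beta\in\mathcal{KL}$ and $\psi\in\mathcal K_\infty$ such that every solution pair $(q,w)$ with $w$ bounded, $\tilde v_i(0,0)=g_{v_i}(x(0,0))$ and $\theta_i(0,0)=0$ for all $i$ satisfies $$\|q(t,j)\|_{\mathcal S}\le\beta(\|q(0,0)\|_{\mathcal S},t+j)+\psi(\|w\|_\infty)\quad\text{for all }(t,j)\in\operatorname{dom}q,$$ where $\|q\|_{\mathcal S}$ is the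 Euclidean distance to $\mathcal S$, and $\|w\|_\infty$ is the maximum of the essential supremum of $\|w\|$ over the flow times and its supremum over the jump times. -/

import Mathlib

open Set Filter Topology MeasureTheory
open scoped ENNReal

noncomputable section

/-- `ℝⁿ` with its Euclidean norm. -/
abbrev Vec (n : ℕ) : Type := EuclideanSpace ℝ (Fin n)

/-! ### Comparison functions -/

/-- Class `K` functions on `[0, ∞)`. -/
def IsClassK (α : ℝ → ℝ) : Prop :=
  ContinuousOn α (Ici 0) ∧ StrictMonoOn α (Ici 0) ∧ α 0 = 0

/-- Class `K_∞` functions on `[0, ∞)`. -/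
def IsClassKInf (α : ℝ → ℝ) : Prop :=
  IsClassK α ∧ Tendsto α atTop atTop

/-- Class `KL` functions on `[0, ∞) × [0, ∞)`. -/
def IsClassKL (β : ℝ → ℝ → ℝ) : Prop :=
  ContinuousOn (fun p : ℝ × ℝ => β p.1 p.2) (Ici 0 ×ˢ Ici 0) ∧
  (∀ t, 0 ≤ t → IsClassK fun s => β s t) ∧
  (∀ s, 0 ≤ s → AntitoneOn (β s) (Ici 0) ∧ Tendsto (β s) atTop (𝓝 0))

/-! ### The networked control system -/

/-- A plant `ẋ_p = f_p(x_p, û, w)`, `y = g_p(x_p)`, a controller `ẋ_c = f_c(x_c, ŷ)`,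
`u = g_c(x_c)`, and `N` independent channels.  The map `fp` may depend on `ŷ` as well: for a
dynamic controller it ignores that argument, and a static controller `û = κ(ŷ)` (`n_c = n_u = 0`,
only `y` is transmitted) is the case `fp x_p _ ŷ w = f_p(x_p, κ(ŷ), w)`.  The coordinates of `v = (y, u)` are distributed
over the channels by the bijection `part`; channel `i` carries `v_i ∈ ℝ^{nv i}`. -/
structure NCS (N np nc ny nu nw : ℕ) where
  /-- Plant dynamics, as a function of `x_p`, `û`, `ŷ`, `w`. -/
  fp : Vec np → Vec nu → Vec ny → Vec nw → Vec np
  /-- Plant output. -/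
  gp : Vec np → Vec ny
  /-- Controller dynamics. -/
  fc : Vec nc → Vec ny → Vec nc
  /-- Controller output. -/
  gc : Vec nc → Vec nu
  fp_cont :
    Continuous fun p : Vec np × Vec nu × Vec ny × Vec nw => fp p.1 p.2.1 p.2.2.1 p.2.2.2
  fc_cont : Continuous fun p : Vec nc × Vec ny => fc p.1 p.2
  gp_smooth : ContDiff ℝ 1 gp
  gc_smooth : ContDiff ℝ 1 gc
  fp_zero : fp 0 0 0 0 = 0
  fc_zero : fc 0 0 = 0
  gp_zero : gp 0 = 0
  gc_zero : gc 0 = 0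
  /-- Size of the signal carried by each channel. -/
  nv : Fin N → ℕ
  /-- Distribution of the coordinates of `(y, u)` over the channels. -/
  part : (Σ i, Fin (nv i)) ≃ Fin ny ⊕ Fin nu
  /-- Scheduling protocols `h_{v_i}(k, ē_i)`. -/
  h : (i : Fin N) → ℕ → Vec (nv i) → Vec (nv i)
  /-- Maximum allowable delay numbers in sampling. -/
  D : Fin N → ℕ
  /-- Lower bounds of the inter-sampling times. -/
  Tm : Fin N → ℝ
  /-- Upper bounds of the inter-sampling times. -/
  TM : Fin N → ℝ
  Tm_pos : ∀ i, 0 < Tm i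
  Tm_le : ∀ i, Tm i ≤ TM i

namespace NCS

variable {N np nc ny nu nw : ℕ} (P : NCS N np nc ny nu nw)

/-- The plant-controller state space, `x = (x_p, x_c)`. -/
abbrev X (_ : NCS N np nc ny nu nw) : Type := EuclideanSpace ℝ (Fin np ⊕ Fin nc)

/-- Disturbance values. -/
abbrev Dist (_ : NCS N np nc ny nu nw) : Type := Vec nw

/-- Signals of channel `i`. -/
abbrev Sig (i : Fin N) : Type := Vec (P.nv i)

/-- The updating error `e = (e_1, …, e_N)`. -/
abbrev Err : Type := (i : Fin N) → P.Sig i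

/-- The memory vector `θ_i = (θ_{i,1}, …, θ_{i,D_i+1})`; the block `θ_{i,j}` has index `j - 1`. -/
abbrev Mem (i : Fin N) : Type := Fin (P.D i + 1) → P.Sig i

/-- The plant part of `x`. -/
def xp (x : P.X) : Vec np := WithLp.toLp 2 fun a => x (Sum.inl a)

/-- The controller part of `x`. -/
def xc (x : P.X) : Vec nc := WithLp.toLp 2 fun a => x (Sum.inr a)

/-- `v_i = g_{v_i}(x)`: the coordinates of `(g_p(x_p), g_c(x_c))` that belong to channel `i`. -/
def gv (i : Fin N) (x : P.X) : P.Sig i :=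
  WithLp.toLp 2 fun a =>
    Sum.elim (fun b => P.gp (P.xp x) b) (fun b => P.gc (P.xc x) b) (P.part ⟨i, a⟩)

/-- `e_y = ŷ - y`, collected from the channels. -/
def ey (e : P.Err) : Vec ny :=
  WithLp.toLp 2 fun b => e (P.part.symm (Sum.inl b)).1 (P.part.symm (Sum.inl b)).2

/-- `e_u = û - u`, collected from the channels. -/
def eu (e : P.Err) : Vec nu :=
  WithLp.toLp 2 fun b => e (P.part.symm (Sum.inr b)).1 (P.part.symm (Sum.inr b)).2

/-- Closed-loop vector field of `x`:
`f = (f_p(x_p, g_c(x_c) + e_u, w), f_c(x_c, g_p(x_p) + e_y))` for a dynamic controller. -/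
def f (x : P.X) (e : P.Err) (w : P.Dist) : P.X :=
  WithLp.toLp 2 (Sum.elim
    (fun a => P.fp (P.xp x) (P.gc (P.xc x) + P.eu e) (P.gp (P.xp x) + P.ey e) w a)
    (fun a => P.fc (P.xc x) (P.gp (P.xp x) + P.ey e) a))

/-- `f_{v_i} = (∂g_{v_i}/∂x) f`; the error `e_i` flows along `-f_{v_i}`. -/
def fv (i : Fin N) (x : P.X) (e : P.Err) (w : P.Dist) : P.Sig i :=
  fderiv ℝ (P.gv i) x (P.f x e w)

/-! ### States of the hybrid system -/

/-- `q = (x, e, θ, ṽ, τ̂, k̄, k̃, l, m̂, η)`. -/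
structure State where
  /-- Plant and controller state. -/
  x : P.X
  /-- Updating errors. -/
  e : P.Err
  /-- Memory of the scheduled but not yet updated increments. -/
  θ : (i : Fin N) → P.Mem i
  /-- Last sampled signals. -/
  vs : (i : Fin N) → P.Sig i
  /-- Time since the last sampling. -/
  τ : Fin N → ℝ
  /-- Number of transmissions. -/
  kt : Fin N → ℕ
  /-- Number of updates. -/
  ku : Fin N → ℕ
  /-- Number of pending transmissions. -/
  l : Fin N → ℤ
  /-- Next action: sampling (possibly with a transmission) is `1`, update is `-1`. -/
  m : Fin N → ℤ
  /-- Auxiliary variables of the event triggers. -/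
  η : Fin N → ℝ

variable {P}

/-- Euclidean distance of two states, over all of their components. -/
def State.dist (q r : P.State) : ℝ :=
  √(‖q.x - r.x‖ ^ 2 + ∑ i, ‖q.e i - r.e i‖ ^ 2 + ∑ i, ∑ j, ‖q.θ i j - r.θ i j‖ ^ 2
    + ∑ i, ‖q.vs i - r.vs i‖ ^ 2 + ∑ i, (q.τ i - r.τ i) ^ 2
    + ∑ i, ((q.kt i : ℝ) - r.kt i) ^ 2 + ∑ i, ((q.ku i : ℝ) - r.ku i) ^ 2
    + ∑ i, ((q.l i : ℝ) - r.l i) ^ 2 + ∑ i, ((q.m i : ℝ) - r.m i) ^ 2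
    + ∑ i, (q.η i - r.η i) ^ 2)

/-- `‖q‖_Ω`, the distance of a state to a set of states. -/
def State.distTo (q : P.State) (Ω : Set P.State) : ℝ := sInf ((fun r => q.dist r) '' Ω)

variable (P)

/-- Admissible pairs `(l_i, θ_i)`: `0 ≤ l_i ≤ D_i + 1`, and `θ_{i,j} = 0` for `j > l_i`. -/
def Adm (i : Fin N) (l : ℤ) (θ : P.Mem i) : Prop :=
  0 ≤ l ∧ l ≤ P.D i + 1 ∧ ∀ j : Fin (P.D i + 1), l ≤ (j : ℤ) → θ j = 0

/-- The state space `𝒳`. -/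
def stateSpace : Set P.State :=
  {q | ∀ i, P.Adm i (q.l i) (q.θ i) ∧ 0 ≤ q.τ i ∧ (q.m i = 1 ∨ q.m i = -1) ∧ 0 ≤ q.η i}

/-- The flow set `𝒞`. -/
def flowSet : Set P.State := {q | q ∈ P.stateSpace ∧ ∀ i, q.τ i ∈ Icc 0 (P.TM i)}

/-- The part `𝒟_i` of the jump set that belongs to channel `i`. -/
def jumpSet (i : Fin N) : Set P.State := {q | q ∈ P.stateSpace ∧ q.τ i ∈ Icc (P.Tm i) (P.TM i)}

/-- The set `𝒮` to be stabilized. -/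
def target : Set P.State := {q | q ∈ P.stateSpace ∧ q.x = 0 ∧ q.e = 0 ∧ q.η = 0}

/-- Dynamics of the auxiliary variables `η_i` and triggering functions.  They are allowed to be
any functions of the whole state. -/
structure Trigger where
  /-- Flow of `η_i`. -/
  fη : Fin N → P.State → ℝ
  /-- Value of `η_i` after a transmission. -/
  gt : Fin N → P.State → ℝ
  /-- Triggering function, and value of `η_i` after a sampling without transmission. -/
  gs : Fin N → P.State → ℝ
  fη_nonneg : ∀ i, ∀ q ∈ P.stateSpace, q.η i = 0 → 0 ≤ fη i q
  gt_nonneg : ∀ i, ∀ q ∈ P.stateSpace, 0 ≤ gt i q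

/-- `ξ_m(p) = -1` if `m = p`, and `1` otherwise. -/
def xi (m p : ℤ) : ℤ := if m = p then -1 else 1

/-- `∑_{j=1}^{l} θ_{i,j}`. -/
def memSum {i : Fin N} (l : ℤ) (θ : P.Mem i) : P.Sig i :=
  ∑ j : Fin (P.D i + 1), if (j : ℤ) < l then θ j else 0

/-- `θ_i` after a transmission:
`(θ_{i,1}, …, θ_{i,l}, h_{v_i}(k̄_i, e_i + ∑_{j≤l} θ_{i,j}) - e_i - ∑_{j≤l} θ_{i,j}, 0, …, 0)`. -/
def memPush (i : Fin N) (k : ℕ) (l : ℤ) (θ : P.Mem i) (ε : P.Sig i) : P.Mem i := fun j =>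
  if (j : ℤ) < l then θ j
  else if (j : ℤ) = l then P.h i k (ε + P.memSum l θ) - ε - P.memSum l θ
  else 0

/-- `θ_i` after an update: `(θ_{i,2}, …, θ_{i,D_i+1}, 0)`. -/
def memPop (i : Fin N) (θ : P.Mem i) : P.Mem i := fun j =>
  if hj : (j : ℕ) + 1 < P.D i + 1 then θ ⟨(j : ℕ) + 1, hj⟩ else 0

variable {P}

/-- Jump of channel `i` at a transmission. -/
def jumpTransmit (T : P.Trigger) (i : Fin N) (q : P.State) : Set P.State :=
  {r | ∃ μ : ℤ, (μ = -1 ∨ μ = xi (P.D i) (q.l i)) ∧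
    r = { q with
      θ := Function.update q.θ i (P.memPush i (q.kt i) (q.l i) (q.θ i) (q.e i))
      vs := Function.update q.vs i (P.gv i q.x)
      τ := Function.update q.τ i 0
      kt := Function.update q.kt i (q.kt i + 1)
      l := Function.update q.l i (q.l i + 1)
      m := Function.update q.m i μ
      η := Function.update q.η i (T.gt i q) }}

/-- Jump of channel `i` at a sampling without transmission. -/
def jumpSample (T : P.Trigger) (i : Fin N) (q : P.State) : Set P.State :=
  {r | r = { q with
      vs := Function.update q.vs i (P.gv i q.x)
      τ := Function.update q.τ i 0
      η := Function.update q.η i (T.gs i q) }}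

/-- Jump of channel `i` at an update. -/
def jumpUpdate (i : Fin N) (q : P.State) : Set P.State :=
  {r | ∃ μ : ℤ, (μ = -xi 1 (q.l i) ∨ μ = 1) ∧
    r = { q with
      e := Function.update q.e i (q.e i + q.θ i 0)
      θ := Function.update q.θ i (P.memPop i (q.θ i))
      ku := Function.update q.ku i (q.ku i + 1)
      l := Function.update q.l i (q.l i - 1)
      m := Function.update q.m i μ }}

/-- The jump map `G_i` of channel `i`. -/
def jumpMap (T : P.Trigger) (i : Fin N) (q : P.State) : Set P.State :=
  {r | q ∈ P.jumpSet i ∧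
    ((q.m i = 1 ∧ T.gs i q ≤ 0 ∧ r ∈ jumpTransmit T i q) ∨
     (q.m i = 1 ∧ 0 ≤ T.gs i q ∧ r ∈ jumpSample T i q) ∨
     (q.m i = -1 ∧ r ∈ jumpUpdate i q))}

end NCS

/-! ### Hybrid time domains and solutions -/

/-- Compact hybrid time domains: `⋃_{j<n} [t_j, t_{j+1}] × {j}` with
`0 = t_0 ≤ t_1 ≤ … ≤ t_n`. -/
def IsCompactHybridTimeDomain (E : Set (ℝ × ℕ)) : Prop :=
  ∃ (n : ℕ) (t : ℕ → ℝ), t 0 = 0 ∧ Monotone t ∧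
    E = ⋃ j ∈ {j : ℕ | j < n}, Icc (t j) (t (j + 1)) ×ˢ {j}

/-- Hybrid time domains: all truncations at a point of the set are compact hybrid time domains. -/
def IsHybridTimeDomain (E : Set (ℝ × ℕ)) : Prop :=
  E.Nonempty ∧ (∀ p ∈ E, 0 ≤ p.1) ∧
  ∀ p ∈ E, IsCompactHybridTimeDomain (E ∩ Icc 0 p.1 ×ˢ Iic p.2)

/-- `I^j = {t | (t, j) ∈ E}`. -/
def hybridSlice (E : Set (ℝ × ℕ)) (j : ℕ) : Set ℝ := {t | (t, j) ∈ E}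

/-- `‖w‖_∞` of a hybrid signal on the hybrid time domain `E`: the larger one of the essential
supremum over the flow intervals and the supremum over the jump times. -/
def hybridSupNorm {F : Type*} [NormedAddCommGroup F] (E : Set (ℝ × ℕ)) (w : ℝ → ℕ → F) : ℝ≥0∞ :=
  (⨆ j : ℕ, eLpNormEssSup (fun t => w t j) (volume.restrict (hybridSlice E j))) ⊔
  (⨆ (t : ℝ) (j : ℕ) (_ : (t, j) ∈ E) (_ : (t, j + 1) ∈ E), ‖w t j‖ₑ)

/-- Local absolute continuity on a set of times (used for intervals). -/
def LocallyAC {F : Type*} [NormedAddCommGroup F] (g : ℝ → F) (I : Set ℝ) : Prop :=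
  ∀ a ∈ I, ∀ b ∈ I, AbsolutelyContinuousOnInterval g a b

namespace NCS

variable {N np nc ny nu nw : ℕ} {P : NCS N np nc ny nu nw}

/-- `(q, w)` is a solution pair of the closed-loop hybrid system with hybrid time domain `E`. -/
structure IsSolution (T : P.Trigger) (E : Set (ℝ × ℕ)) (q : ℝ → ℕ → P.State)
    (w : ℝ → ℕ → P.Dist) : Prop where
  domain : IsHybridTimeDomain E
  meas : ∀ j, AEStronglyMeasurable (fun t => w t j) (volume.restrict (hybridSlice E j))
  init : q 0 0 ∈ P.flowSet ∨ ∃ i, q 0 0 ∈ P.jumpSet i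
  mem : ∀ t j, (t, j) ∈ E → q t j ∈ P.stateSpace
  /-- Flows stay in the flow set. -/
  flow_mem : ∀ j, ∀ t ∈ interior (hybridSlice E j), q t j ∈ P.flowSet
  ac_x : ∀ j, LocallyAC (fun t => (q t j).x) (hybridSlice E j)
  ac_e : ∀ j i, LocallyAC (fun t => (q t j).e i) (hybridSlice E j)
  ac_η : ∀ j i, LocallyAC (fun t => (q t j).η i) (hybridSlice E j)
  flow_x : ∀ j, ∀ᵐ t ∂(volume.restrict (hybridSlice E j)),
    HasDerivAt (fun s => (q s j).x) (P.f (q t j).x (q t j).e (w t j)) t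
  flow_e : ∀ j i, ∀ᵐ t ∂(volume.restrict (hybridSlice E j)),
    HasDerivAt (fun s => (q s j).e i) (-P.fv i (q t j).x (q t j).e (w t j)) t
  flow_η : ∀ j i, ∀ᵐ t ∂(volume.restrict (hybridSlice E j)),
    HasDerivAt (fun s => (q s j).η i) (T.fη i (q t j)) t
  /-- The timers grow with slope one. -/
  flow_τ : ∀ j, ∀ s ∈ hybridSlice E j, ∀ t ∈ hybridSlice E j, ∀ i,
    (q t j).τ i = (q s j).τ i + (t - s)
  /-- The other components are constant along flows. -/
  flow_const : ∀ j, ∀ s ∈ hybridSlice E j, ∀ t ∈ hybridSlice E j,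
    (q t j).θ = (q s j).θ ∧ (q t j).vs = (q s j).vs ∧ (q t j).kt = (q s j).kt ∧
    (q t j).ku = (q s j).ku ∧ (q t j).l = (q s j).l ∧ (q t j).m = (q s j).m
  jump : ∀ t j, (t, j) ∈ E → (t, j + 1) ∈ E → ∃ i, q t (j + 1) ∈ jumpMap T i (q t j)

/-- Input-to-state stability of a set `Ω` with respect to `w`.  Initially the sampled signals are
the current ones, and no transmission is pending, so that the memory `θ` is zero. -/
def InputToStateStable (T : P.Trigger) (Ω : Set P.State) : Prop :=
  ∃ (β : ℝ → ℝ → ℝ) (ψ : ℝ → ℝ), IsClassKL β ∧ IsClassKInf ψ ∧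
    ∀ (E : Set (ℝ × ℕ)) (q : ℝ → ℕ → P.State) (w : ℝ → ℕ → P.Dist),
      IsSolution T E q w → hybridSupNorm E w ≠ ∞ →
      (∀ i, (q 0 0).vs i = P.gv i (q 0 0).x) → (q 0 0).θ = 0 →
      ∀ t j, (t, j) ∈ E →
        (q t j).distTo Ω ≤ β ((q 0 0).distTo Ω) (t + j) + ψ (hybridSupNorm E w).toReal

/-! ### Storage functions -/

variable (P)

/-- `‖[e_i, θ_i]‖`. -/
def errNorm {i : Fin N} (ε : P.Sig i) (θ : P.Mem i) : ℝ := √(‖ε‖ ^ 2 + ∑ j, ‖θ j‖ ^ 2)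

/-- Storage functions `W̃_i(k̄_i, l_i, θ_i, e_i)` of the updating errors, with their bounds.
Only the indices `0 ≤ l ≤ D_i + 1` of the families `H`, `L` are used. -/
structure ErrorStorage where
  W : (i : Fin N) → ℕ → ℤ → P.Mem i → P.Sig i → ℝ
  βlo : Fin N → ℝ → ℝ
  βhi : Fin N → ℝ → ℝ
  H : (i : Fin N) → ℤ → P.X → P.Err → P.Dist → ℝ
  L : Fin N → ℤ → ℝ
  lam : Fin N → ℝ

/-- The properties required of the storage functions of the updating errors. -/
structure ErrorStorage.Valid (A : P.ErrorStorage) : Prop where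
  lipschitz : ∀ (i : Fin N) (k : ℕ) (l : ℤ), 0 ≤ l → l ≤ P.D i + 1 →
    LocallyLipschitzOn {p : P.Mem i × P.Sig i | P.Adm i l p.1} fun p => A.W i k l p.1 p.2
  βlo_class : ∀ i, IsClassKInf (A.βlo i)
  βhi_class : ∀ i, IsClassKInf (A.βhi i)
  H_cont : ∀ (i : Fin N) (l : ℤ), 0 ≤ l → l ≤ P.D i + 1 →
    Continuous fun p : P.X × P.Err × P.Dist => A.H i l p.1 p.2.1 p.2.2
  H_nonneg : ∀ (i : Fin N) (l : ℤ), 0 ≤ l → l ≤ P.D i + 1 → ∀ x e w, 0 ≤ A.H i l x e w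
  L_pos : ∀ (i : Fin N) (l : ℤ), 0 ≤ l → l ≤ P.D i + 1 → 0 < A.L i l
  lam_pos : ∀ i, 0 < A.lam i
  lam_lt : ∀ i, A.lam i < 1
  lower : ∀ (i : Fin N) (k : ℕ) (l : ℤ) (θ : P.Mem i), P.Adm i l θ → ∀ ε, A.βlo i (P.errNorm ε θ) ≤ A.W i k l θ ε
  upper : ∀ (i : Fin N) (k : ℕ) (l : ℤ) (θ : P.Mem i), P.Adm i l θ → ∀ ε, A.W i k l θ ε ≤ A.βhi i (P.errNorm ε θ)
  transmit : ∀ (i : Fin N) (k : ℕ) (l : ℤ) (θ : P.Mem i), P.Adm i l θ → l ≤ P.D i → ∀ ε,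
    A.W i (k + 1) (l + 1) (P.memPush i k l θ ε) ε ≤ A.lam i * A.W i k l θ ε
  update : ∀ (i : Fin N) (k : ℕ) (l : ℤ) (θ : P.Mem i), P.Adm i l θ → 1 ≤ l → ∀ ε,
    A.W i k (l - 1) (P.memPop i θ) (ε + θ 0) ≤ A.W i k l θ ε
  flow : ∀ (i : Fin N) (k : ℕ) (l : ℤ) (θ : P.Mem i), P.Adm i l θ → ∀ (x : P.X) (e : P.Err) (w : P.Dist), ∀ᵐ ε : P.Sig i,
    fderiv ℝ (A.W i k l θ) ε (-P.fv i x (Function.update e i ε) w)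
      ≤ A.L i l * A.W i k l θ ε + A.H i l x (Function.update e i ε) w

/-- Storage functions of the plant-controller state and of the transmitted signals. -/
structure PlantStorage where
  V : P.X → ℝ
  /-- `δ̃_i`. -/
  δ : (i : Fin N) → P.Sig i → ℝ
  /-- `δ̂_i`. -/
  δh : (i : Fin N) → P.Sig i → ℝ
  βVlo : ℝ → ℝ
  βVhi : ℝ → ℝ
  βδlo : Fin N → ℝ → ℝ
  βδhi : Fin N → ℝ → ℝ
  αV : ℝ → ℝ
  αw : ℝ → ℝ
  σ : Fin N → ℤ → ℝ → ℝ
  J : (i : Fin N) → P.X → P.Err → P.Dist → ℝ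
  γ : Fin N → ℤ → ℝ
  ϵ : Fin N → ℤ → ℝ

/-- The properties required of the storage functions of the plant-controller state and of the
transmitted signals. -/
structure PlantStorage.Valid (A : P.ErrorStorage) (B : P.PlantStorage) : Prop where
  V_lipschitz : LocallyLipschitz B.V
  δ_lipschitz : ∀ i, LocallyLipschitz (B.δ i)
  δh_lipschitz : ∀ i, LocallyLipschitz (B.δh i)
  δ_zero : ∀ i, B.δ i 0 = 0
  δh_nonneg : ∀ i ν, 0 ≤ B.δh i ν
  βVlo_class : IsClassKInf B.βVlo
  βVhi_class : IsClassKInf B.βVhi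
  βδlo_class : ∀ i, IsClassKInf (B.βδlo i)
  βδhi_class : ∀ i, IsClassKInf (B.βδhi i)
  αV_class : IsClassKInf B.αV
  αw_class : IsClassKInf B.αw
  σ_class : ∀ (i : Fin N) (l : ℤ), 0 ≤ l → l ≤ P.D i + 1 → IsClassKInf (B.σ i l)
  J_cont : ∀ i, Continuous fun p : P.X × P.Err × P.Dist => B.J i p.1 p.2.1 p.2.2
  J_nonneg : ∀ i x e w, 0 ≤ B.J i x e w
  γ_pos : ∀ (i : Fin N) (l : ℤ), 0 ≤ l → l ≤ P.D i + 1 → 0 < B.γ i l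
  ϵ_nonneg : ∀ (i : Fin N) (l : ℤ), 0 ≤ l → l ≤ P.D i + 1 → 0 ≤ B.ϵ i l
  V_lower : ∀ x, B.βVlo ‖x‖ ≤ B.V x
  V_upper : ∀ x, B.V x ≤ B.βVhi ‖x‖
  δ_lower : ∀ i ν, B.βδlo i ‖ν‖ ≤ B.δ i ν
  δ_upper : ∀ i ν, B.δ i ν ≤ B.βδhi i ‖ν‖
  flow_V : ∀ᵐ x : P.X, ∀ (e : P.Err) (w : P.Dist)
    (k : Fin N → ℕ) (l : Fin N → ℤ) (θ : (i : Fin N) → P.Mem i), (∀ i, P.Adm i (l i) (θ i)) →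
    fderiv ℝ B.V x (P.f x e w) ≤ -B.αV ‖x‖
      + ∑ i, (B.γ i (l i) ^ 2 * A.W i (k i) (l i) (θ i) (e i) ^ 2
          - B.δ i (P.gv i x)
          - B.σ i (l i) (A.W i (k i) (l i) (θ i) (e i))
          - (1 + B.ϵ i (l i)) * A.H i (l i) x e w ^ 2
          - B.δh i (P.gv i x + e i)
          - (1 + B.ϵ i (l i)) * B.J i x e w)
      + B.αw ‖w‖
  /-- Derivative of `δ̃_i(v_i)`, `v_i = g_{v_i}(x)`, along `f`, that is `⟨∇δ̃_i(v_i), f_{v_i}⟩`. -/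
  flow_δ : ∀ᵐ x : P.X, ∀ (e : P.Err) (w : P.Dist) (i : Fin N) (l : ℤ), 0 ≤ l → l ≤ P.D i + 1 →
    fderiv ℝ (fun y => B.δ i (P.gv i y)) x (P.f x e w) ≤ A.H i l x e w ^ 2 + B.J i x e w

variable {P}

/-- `γ̄_i = max_{0 ≤ l ≤ D_i + 1} γ_{l,i}`. -/
def PlantStorage.γmax (B : P.PlantStorage) (i : Fin N) : ℝ :=
  (Finset.Icc (0 : ℤ) (P.D i + 1)).sup' ⟨0, by simp; omega⟩ (B.γ i)

/-- `W̃_i` evaluated along a state. -/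
def ErrorStorage.Wq (A : P.ErrorStorage) (i : Fin N) (q : P.State) : ℝ :=
  A.W i (q.kt i) (q.l i) (q.θ i) (q.e i)

variable (P) in
/-- `ϖ_i(τ)`: the solution of `ϖ' = -(1 - π_i)/T_M^i`, `ϖ(0) = 1`. -/
def varpi (π : Fin N → ℝ) (i : Fin N) (τ : ℝ) : ℝ := 1 - (1 - π i) / P.TM i * τ

variable (P) in
/-- `ρ̃_i = min {ρ̄_i (1 - π_i)/T_M^i, π_i/2}`. -/
def rhoTilde (π ρbar : Fin N → ℝ) (i : Fin N) : ℝ :=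
  min (ρbar i * (1 - π i) / P.TM i) (π i / 2)

end NCS

end

noncomputable section

/-! The proof is a Lyapunov argument with a hybrid storage function `U` (`storage`): the plant
storage `V` plus, for each channel, `η`, a multiple of `max (δ(v)) (ϖ(τ) δ(ṽ))`, and `max (γ φ(τ)
W²) (ρhat δ(v))`. The weights `φ` and `ϖ` depend on the time since the last sampling.

`U` does not increase at jumps (`storage_jump_le`). For transmissions and samplings this is what the
bounds on `gt` and `gs` say; for updates, `W` does not grow and `γ φ` is monotone in the number of
pending transmissions. Along flows, `U' ≤ -D + αw(‖w‖∞)` with the rate `D` of `dissipation`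
(`storage_flow`). The Riccati equation of `φ` makes the error terms complete a square
(`channel_dissipation`), and the slope of `ϖ` pays for the sampled values that feed `η`.

All storage functions are only locally Lipschitz and their inequalities hold only almost everywhere
in the state space, while a trajectory may stay inside a null set.
`LocallyLipschitz.deriv_le_of_ae_fderiv_le` transfers such inequalities to every curve, at each time
where the derivative exists. A maximum is handled at points of differentiability, where its
derivative is that of an active branch (`HasDerivAt.max_cases`).

Since `U` is bounded by a gain of `D` (`exists_storage_le_gain_dissipation`), `D ≥ α(U)` for some
`α` of class `K_∞`, so `U' ≤ -α(U)/2` above a level fixed by the disturbance. A rescaling `ρ` makes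
this decay exponential in `t`. Timers and pending transmissions bound the number of jumps by an
affine function of `t` (`jumps_le`), so the decay is also exponential in `t + j`. Finally `U`
dominates the distance to the target at all times, and is dominated by it initially, where `ṽ = v`
and `θ = 0`. -/

/-! ### Calculus of comparison functions -/

/-- Nondecreasing continuous functions on `[0, ∞)` that vanish at zero. -/
def IsGain (κ : ℝ → ℝ) : Prop :=
  ContinuousOn κ (Ici 0) ∧ MonotoneOn κ (Ici 0) ∧ κ 0 = 0

namespace IsGain

variable {κ κ' : ℝ → ℝ}

lemma nonneg (h : IsGain κ) {s : ℝ} (hs : 0 ≤ s) : 0 ≤ κ s := by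
  rw [← h.2.2]; exact h.2.1 self_mem_Ici hs hs

lemma le_of_le (h : IsGain κ) {s t : ℝ} (hs : 0 ≤ s) (hst : s ≤ t) : κ s ≤ κ t :=
  h.2.1 hs (hs.trans hst) hst

lemma mapsTo (h : IsGain κ) : MapsTo κ (Ici 0) (Ici 0) := fun _ hs => h.nonneg hs

lemma id : IsGain fun s => s := ⟨continuousOn_id, monotoneOn_id, rfl⟩

lemma zero : IsGain fun _ => 0 := ⟨continuousOn_const, monotoneOn_const, rfl⟩

lemma add (h : IsGain κ) (h' : IsGain κ') : IsGain fun s => κ s + κ' s :=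
  ⟨h.1.add h'.1, h.2.1.add h'.2.1, by simp [h.2.2, h'.2.2]⟩

lemma sum {ι : Type*} {k : ι → ℝ → ℝ} (S : Finset ι) (h : ∀ i ∈ S, IsGain (k i)) :
    IsGain fun s => ∑ i ∈ S, k i s := by
  refine ⟨continuousOn_finsetSum _ fun i hi => (h i hi).1, fun s hs t ht hst =>
    Finset.sum_le_sum fun i hi => (h i hi).2.1 hs ht hst, Finset.sum_eq_zero fun i hi => (h i hi).2.2⟩

lemma const_mul (h : IsGain κ) {c : ℝ} (hc : 0 ≤ c) : IsGain fun s => c * κ s :=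
  ⟨continuousOn_const.mul h.1, fun _ hs _ ht hst => mul_le_mul_of_nonneg_left (h.2.1 hs ht hst) hc,
    by simp [h.2.2]⟩

lemma comp (h : IsGain κ) (h' : IsGain κ') : IsGain fun s => κ (κ' s) :=
  ⟨h.1.comp h'.1 h'.mapsTo, fun _ hs _ ht hst =>
    h.2.1 (h'.nonneg hs) (h'.nonneg ht) (h'.2.1 hs ht hst), by simp [h.2.2, h'.2.2]⟩

lemma sq (h : IsGain κ) : IsGain fun s => κ s ^ 2 :=
  ⟨h.1.pow 2, fun _ hs _ ht hst => pow_le_pow_left₀ (h.nonneg hs) (h.2.1 hs ht hst) 2,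
    by simp [h.2.2]⟩

lemma sqrt : IsGain fun s => √s :=
  ⟨Real.continuous_sqrt.continuousOn, fun _ _ _ _ h => Real.sqrt_le_sqrt h, Real.sqrt_zero⟩

lemma le_sum {ι : Type*} {k : ι → ℝ → ℝ} {S : Finset ι} (h : ∀ i ∈ S, IsGain (k i)) {i : ι}
    (hi : i ∈ S) {s : ℝ} (hs : 0 ≤ s) : k i s ≤ ∑ i ∈ S, k i s :=
  Finset.single_le_sum (f := fun i => k i s) (fun j hj => (h j hj).nonneg hs) hi

/-- The sum is at most twice its larger summand. This separates the effect of the initial state from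
that of the disturbance. -/
lemma add_le (h : IsGain κ) {s t : ℝ} (hs : 0 ≤ s) (ht : 0 ≤ t) :
    κ (s + t) ≤ κ (2 * s) + κ (2 * t) := by
  rcases le_total s t with hst | hst
  · linarith [h.le_of_le (by linarith) (by linarith : s + t ≤ 2 * t),
      h.nonneg (by linarith : 0 ≤ 2 * s)]
  · linarith [h.le_of_le (by linarith) (by linarith : s + t ≤ 2 * s),
      h.nonneg (by linarith : 0 ≤ 2 * t)]

/-- A continuous function that vanishes at the origin is bounded by a gain of the norm. -/
lemma exists_of_continuous {E : Type*} [NormedAddCommGroup E] [NormedSpace ℝ E] [ProperSpace E]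
    {f : E → ℝ} (hf : Continuous f) (h0 : f 0 = 0) : ∃ κ, IsGain κ ∧ ∀ x, f x ≤ κ ‖x‖ := by
  have hK : IsCompact (Metric.closedBall (0 : E) 1) := isCompact_closedBall 0 1
  have hF : Continuous fun p : ℝ × E => f (p.1 • p.2) := by fun_prop
  have hbdd (r : ℝ) : BddAbove ((fun y => f (r • y)) '' Metric.closedBall (0 : E) 1) :=
    (hK.image (by fun_prop)).bddAbove
  -- The gain at radius `r` is the maximum of `f` over the closed ball of radius `r`. Parametrizing
  -- by the fixed unit ball makes continuity in `r` a fact about suprema over one compact set.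
  refine ⟨fun r => sSup ((fun y => f (r • y)) '' Metric.closedBall (0 : E) 1), ⟨?_, ?_, ?_⟩, ?_⟩
  · exact (hK.continuous_sSup (f := fun (r : ℝ) y => f (r • y)) hF).continuousOn
  · intro s hs t ht hst
    refine csSup_le ⟨f (s • 0), 0, by simp, rfl⟩ ?_
    rintro _ ⟨y, hy, rfl⟩
    rcases eq_or_lt_of_le (show (0 : ℝ) ≤ s from hs) with rfl | hs0
    · exact le_csSup (hbdd t) ⟨0, by simp, by simp⟩
    · have ht0 : 0 < t := hs0.trans_le hst
      refine le_csSup (hbdd t) ⟨(s / t) • y, ?_, ?_⟩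
      · simp only [Metric.mem_closedBall, dist_zero_right] at hy ⊢
        rw [norm_smul, Real.norm_of_nonneg (by positivity)]
        exact mul_le_one₀ ((div_le_one ht0).2 hst) (norm_nonneg _) hy
      · simp only [smul_smul]
        rw [mul_div_cancel₀ _ ht0.ne']
  · have : (fun y : E => f ((0 : ℝ) • y)) '' Metric.closedBall (0 : E) 1 = {0} := by
      ext z
      simp only [zero_smul, h0, mem_image, mem_singleton_iff]
      exact ⟨fun ⟨_, _, h⟩ => h.symm, fun h => ⟨0, by simp, h.symm⟩⟩
    simp only [this, csSup_singleton]
  · intro x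
    rcases eq_or_ne x 0 with rfl | hx
    · exact le_csSup (hbdd _) ⟨0, by simp, by simp⟩
    · refine le_csSup (hbdd _) ⟨‖x‖⁻¹ • x, ?_, ?_⟩
      · simp [norm_smul, inv_mul_cancel₀ (norm_ne_zero_iff.2 hx)]
      · simp only [smul_smul]
        rw [mul_inv_cancel₀ (norm_ne_zero_iff.2 hx), one_smul]

end IsGain

namespace IsClassKInf

variable {α β κ : ℝ → ℝ}

lemma isGain (h : IsClassKInf α) : IsGain α := ⟨h.1.1, h.1.2.1.monotoneOn, h.1.2.2⟩

lemma nonneg (h : IsClassKInf α) {s : ℝ} (hs : 0 ≤ s) : 0 ≤ α s := h.isGain.nonneg hs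

lemma pos (h : IsClassKInf α) {s : ℝ} (hs : 0 < s) : 0 < α s := by
  rw [← h.1.2.2]; exact h.1.2.1 self_mem_Ici hs.le hs

lemma comp (h : IsClassKInf α) (h' : IsClassKInf β) : IsClassKInf fun s => α (β s) :=
  ⟨⟨h.1.1.comp h'.1.1 h'.isGain.mapsTo, fun _ hs _ ht hst =>
    h.1.2.1 (h'.nonneg hs) (h'.nonneg ht) (h'.1.2.1 hs ht hst), by simp [h.1.2.2, h'.1.2.2]⟩,
    h.2.comp h'.2⟩

lemma const_mul (h : IsClassKInf α) {c : ℝ} (hc : 0 < c) : IsClassKInf fun s => c * α s :=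
  ⟨⟨continuousOn_const.mul h.1.1, fun _ hs _ ht hst =>
    mul_lt_mul_of_pos_left (h.1.2.1 hs ht hst) hc, by simp [h.1.2.2]⟩, h.2.const_mul_atTop hc⟩

lemma id : IsClassKInf fun s => s :=
  ⟨⟨continuousOn_id, strictMonoOn_id, rfl⟩, tendsto_id⟩

lemma add_gain (h : IsClassKInf α) (hκ : IsGain κ) : IsClassKInf fun s => α s + κ s := by
  refine ⟨⟨h.1.1.add hκ.1, fun s hs t ht hst =>
    add_lt_add_of_lt_of_le (h.1.2.1 hs ht hst) (hκ.2.1 hs ht hst.le),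
    by simp [h.1.2.2, hκ.2.2]⟩, ?_⟩
  refine tendsto_atTop_mono' _ ?_ h.2
  filter_upwards [eventually_ge_atTop 0] with s hs
  linarith [hκ.nonneg hs]

/-- The inverse of a class `K_∞` function. -/
lemma exists_inverse (h : IsClassKInf α) :
    ∃ β, IsClassKInf β ∧ (∀ s, 0 ≤ s → β (α s) = s) ∧ ∀ s, 0 ≤ s → α (β s) = s := by
  -- Extended by the identity to negative arguments, `α` becomes an order isomorphism of `ℝ`, whose
  -- inverse is automatically continuous.
  set g : ℝ → ℝ := fun s => if 0 ≤ s then α s else s with hg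
  have hgn {s : ℝ} (hs : 0 ≤ s) : g s = α s := if_pos hs
  have hmono : StrictMono g := by
    intro s t hst
    simp only [hg]
    split_ifs with h1 h2 h2
    · exact h.1.2.1 h1 h2 hst
    · linarith
    · linarith [h.nonneg h2]
    · exact hst
  have hsurj : Function.Surjective g := by
    intro y
    rcases lt_or_ge y 0 with hy | hy
    · exact ⟨y, if_neg (not_le.2 hy)⟩
    · obtain ⟨b, hb, hb0⟩ := ((h.2.eventually_ge_atTop y).and (eventually_ge_atTop 0)).exists
      obtain ⟨s, hs, rfl⟩ := intermediate_value_Icc hb0 (h.1.1.mono Icc_subset_Ici_self)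
        (show y ∈ Icc (α 0) (α b) from ⟨by rw [h.1.2.2]; exact hy, hb⟩)
      exact ⟨s, hgn hs.1⟩
  set e : ℝ ≃o ℝ := hmono.orderIsoOfSurjective g hsurj with he
  have hge (s : ℝ) : g (e.symm s) = s := e.apply_symm_apply s
  have heg (s : ℝ) : e.symm (g s) = s := e.symm_apply_apply s
  have h0 : e.symm 0 = 0 := by
    have := heg 0
    rwa [hgn le_rfl, h.1.2.2] at this
  refine ⟨e.symm, ⟨⟨e.symm.continuous.continuousOn, e.symm.strictMono.strictMonoOn _, h0⟩,
    e.symm.tendsto_atTop⟩, fun s hs => by rw [← hgn hs, heg], fun s hs => ?_⟩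
  rw [← hgn, hge]
  rw [← h0]
  exact e.symm.monotone hs

lemma le_of_le (h : IsClassKInf α) {s t : ℝ} (hs : 0 ≤ s) (hst : s ≤ t) : α s ≤ α t :=
  h.isGain.le_of_le hs hst

/-- A rescaling `ρ` that turns the decay rate `α` into an exponential one. -/
lemma exists_rescaling (h : IsClassKInf α) :
    ∃ ρ ρ' : ℝ → ℝ, IsClassKInf ρ ∧ ContinuousOn ρ' (Ioi 0) ∧
      ∀ s, 0 < s → HasDerivAt ρ (ρ' s) s ∧ 0 ≤ ρ' s ∧ ρ s ≤ ρ' s * α s := by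
  -- The rescaling is `ρ(s) = exp ∫₁ˢ dr / a(r)`, so that `ρ' = ρ / a ≥ ρ / α`. The cap `a(s) ≤ s`
  -- forces `ρ` to vanish at zero and to be unbounded.
  set a : ℝ → ℝ := fun s => min (α s) s with ha
  have ha_pos {s : ℝ} (hs : 0 < s) : 0 < a s := lt_min (h.pos hs) hs
  have ha_cont : ContinuousOn a (Ioi 0) :=
    (h.1.1.mono Ioi_subset_Ici_self).inf continuousOn_id
  have hb_cont : ContinuousOn (fun s => (a s)⁻¹) (Ioi 0) := ha_cont.inv₀ fun s hs => (ha_pos hs).ne'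
  set G : ℝ → ℝ := fun s => ∫ r in (1 : ℝ)..s, (a r)⁻¹ with hG
  have hG' {s : ℝ} (hs : 0 < s) : HasDerivAt G (a s)⁻¹ s := by
    refine intervalIntegral.integral_hasDerivAt_right ?_ ?_ ?_
    · refine (hb_cont.mono fun r hr => ?_).intervalIntegrable
      exact lt_of_lt_of_le (lt_min one_pos hs) hr.1
    · exact hb_cont.stronglyMeasurableAtFilter isOpen_Ioi s hs
    · exact hb_cont.continuousAt (Ioi_mem_nhds hs)
  -- Comparison with `log`: because `1/a(s) ≥ 1/s`, `exp G` lies below the identity on `(0, 1]` and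
  -- above it on `[1, ∞)`.
  have hlog : MonotoneOn (fun s => G s - Real.log s) (Ioi 0) := by
    have hd {s : ℝ} (hs : 0 < s) : HasDerivAt (fun s => G s - Real.log s) ((a s)⁻¹ - s⁻¹) s :=
      (hG' hs).sub (Real.hasDerivAt_log hs.ne')
    refine monotoneOn_of_deriv_nonneg (convex_Ioi 0)
      (fun s hs => (hd hs).continuousAt.continuousWithinAt)
      (fun s hs => (hd (by simpa using hs)).differentiableAt.differentiableWithinAt) fun s hs => ?_
    have hs' : 0 < s := by simpa using hs
    rw [(hd hs').deriv, sub_nonneg]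
    exact inv_anti₀ (ha_pos hs') (min_le_right _ _)
  have hG1 : G 1 = 0 := intervalIntegral.integral_same
  have hle {s : ℝ} (hs : 0 < s) (hs1 : s ≤ 1) : Real.exp (G s) ≤ s := by
    have := hlog hs (mem_Ioi.2 one_pos) hs1
    simp only [hG1, Real.log_one, sub_zero, sub_nonpos] at this
    exact (Real.exp_le_exp.2 this).trans_eq (Real.exp_log hs)
  have hge {s : ℝ} (hs1 : 1 ≤ s) : s ≤ Real.exp (G s) := by
    have hs : 0 < s := by linarith
    have := hlog (mem_Ioi.2 one_pos) hs hs1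
    simp only [hG1, Real.log_one, sub_zero, sub_nonneg] at this
    exact (Real.exp_log hs).symm.trans_le (Real.exp_le_exp.2 this)
  have hGmono : StrictMonoOn G (Ioi 0) := by
    refine strictMonoOn_of_deriv_pos (convex_Ioi 0)
      (fun s hs => (hG' hs).continuousAt.continuousWithinAt) fun s hs => ?_
    have hs' : 0 < s := by simpa using hs
    rw [(hG' hs').deriv]
    exact inv_pos.2 (ha_pos hs')
  set ρ : ℝ → ℝ := fun s => if 0 < s then Real.exp (G s) else 0 with hρ
  have hρp {s : ℝ} (hs : 0 < s) : ρ s = Real.exp (G s) := if_pos hs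
  have hρ' {s : ℝ} (hs : 0 < s) : HasDerivAt ρ (Real.exp (G s) * (a s)⁻¹) s := by
    refine (hG' hs).exp.congr_of_eventuallyEq ?_
    filter_upwards [Ioi_mem_nhds hs] with r hr using hρp hr
  have hρ0 : ρ 0 = 0 := if_neg (lt_irrefl 0)
  refine ⟨ρ, fun s => Real.exp (G s) * (a s)⁻¹, ⟨⟨?_, ?_, hρ0⟩, ?_⟩, ?_, fun s hs => ⟨hρ' hs, ?_, ?_⟩⟩
  · intro s hs
    rcases eq_or_lt_of_le (show (0 : ℝ) ≤ s from hs) with rfl | hs0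
    · refine Metric.continuousWithinAt_iff.2 fun ε hε => ⟨min ε 1, by positivity, fun r hr hr' => ?_⟩
      rw [Real.dist_eq, sub_zero] at hr'
      rw [hρ0, Real.dist_eq, sub_zero]
      rcases eq_or_lt_of_le (show (0 : ℝ) ≤ r from hr) with rfl | hr0
      · simpa [hρ0] using hε
      · rw [abs_of_pos hr0] at hr'
        rw [hρp hr0, abs_of_pos (Real.exp_pos _)]
        exact (hle hr0 (hr'.le.trans (min_le_right _ _))).trans_lt (hr'.trans_le (min_le_left _ _))
    · exact (hρ' hs0).continuousAt.continuousWithinAt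
  · intro s hs t ht hst
    have ht0 : 0 < t := lt_of_le_of_lt hs hst
    rw [hρp ht0]
    rcases eq_or_lt_of_le (show (0 : ℝ) ≤ s from hs) with rfl | hs0
    · rw [hρ0]; exact Real.exp_pos _
    · rw [hρp hs0]; exact Real.exp_lt_exp.2 (hGmono hs0 ht0 hst)
  · refine tendsto_atTop_mono' _ ?_ tendsto_id
    filter_upwards [eventually_ge_atTop 1] with s hs
    rw [hρp (by linarith)]
    exact hge hs
  · exact (Real.continuous_exp.comp_continuousOn fun s hs =>
      (hG' hs).continuousAt.continuousWithinAt).mul hb_cont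
  · exact mul_nonneg (Real.exp_pos _).le (inv_nonneg.2 (ha_pos hs).le)
  · rw [hρp hs, mul_assoc]
    refine le_mul_of_one_le_right (Real.exp_pos _).le ?_
    rw [inv_mul_eq_div, one_le_div (ha_pos hs)]
    exact min_le_left _ _

/-- Provides the `KL` bound of the theorem: the exponential acts on the rescaled storage, and `α`
undoes the rescaling. -/
lemma isClassKL_exp (hα : IsClassKInf α) (hβ : IsClassKInf β) {c : ℝ} (hc : 0 < c) :
    IsClassKL fun s t => α (Real.exp (-(c * t)) * β s) := by
  refine ⟨?_, fun t _ => (hα.comp (hβ.const_mul (Real.exp_pos _))).1, fun s hs => ⟨?_, ?_⟩⟩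
  · refine hα.1.1.comp (t := Ici 0) ?_ ?_
    · refine ContinuousOn.mul (by fun_prop) ?_
      exact hβ.1.1.comp continuous_fst.continuousOn fun p hp => hp.1
    · intro p hp
      exact mul_nonneg (Real.exp_pos _).le (hβ.nonneg hp.1)
  · intro t _ t' _ htt'
    refine hα.le_of_le (mul_nonneg (Real.exp_pos _).le (hβ.nonneg hs)) ?_
    refine mul_le_mul_of_nonneg_right (Real.exp_le_exp.2 ?_) (hβ.nonneg hs)
    exact neg_le_neg (mul_le_mul_of_nonneg_left htt' hc.le)
  · have h1 : Tendsto (fun t : ℝ => Real.exp (-(c * t)) * β s) atTop (𝓝[Ici 0] 0) := by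
      refine tendsto_nhdsWithin_iff.2 ⟨?_, Eventually.of_forall fun t =>
        mul_nonneg (Real.exp_pos _).le (hβ.nonneg hs)⟩
      have : Tendsto (fun t : ℝ => Real.exp (-(c * t))) atTop (𝓝 0) :=
        Real.tendsto_exp_neg_atTop_nhds_zero.comp (tendsto_id.const_mul_atTop hc)
      simpa using this.mul_const (β s)
    have h2 := (hα.1.1 0 self_mem_Ici).tendsto
    rw [hα.1.2.2] at h2
    exact h2.comp h1

end IsClassKInf

/-! ### Absolutely continuous functions -/

namespace AbsolutelyContinuousOnInterval

/-- Lipschitz images of absolutely continuous functions. -/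
lemma lipschitz_comp {X Y : Type*} [PseudoMetricSpace X] [PseudoMetricSpace Y] {g : X → Y}
    {f : ℝ → X} {a b : ℝ} {K : NNReal} {S : Set X} (hg : LipschitzOnWith K g S)
    (hf : AbsolutelyContinuousOnInterval f a b) (hS : MapsTo f (uIcc a b) S) :
    AbsolutelyContinuousOnInterval (fun t => g (f t)) a b := by
  rw [absolutelyContinuousOnInterval_iff] at hf ⊢
  intro ε hε
  obtain ⟨δ, hδ, h⟩ := hf (ε / (K + 1)) (by positivity)
  refine ⟨δ, hδ, fun E hE hEδ => ?_⟩
  calc ∑ i ∈ Finset.range E.1, dist (g (f (E.2 i).1)) (g (f (E.2 i).2))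
      ≤ ∑ i ∈ Finset.range E.1, K * dist (f (E.2 i).1) (f (E.2 i).2) :=
        Finset.sum_le_sum fun i hi =>
          hg.dist_le_mul _ (hS (hE.1 i hi).1) _ (hS (hE.1 i hi).2)
    _ = K * ∑ i ∈ Finset.range E.1, dist (f (E.2 i).1) (f (E.2 i).2) := by rw [Finset.mul_sum]
    _ ≤ K * (ε / (K + 1)) := by gcongr; exact (h E hE hEδ).le
    _ < ε := by
      rw [mul_div_assoc', div_lt_iff₀ (by positivity), mul_add, mul_one, mul_comm]
      exact lt_add_of_pos_right _ hε

lemma locallyLipschitz_comp {X Y : Type*} [SeminormedAddCommGroup X] [PseudoMetricSpace Y] {g : X → Y}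
    {f : ℝ → X} {a b : ℝ} (hg : LocallyLipschitz g) (hf : AbsolutelyContinuousOnInterval f a b) :
    AbsolutelyContinuousOnInterval (fun t => g (f t)) a b := by
  have hc : ContinuousOn f (uIcc a b) := hf.continuousOn
  have hS : IsCompact (f '' uIcc a b) := isCompact_uIcc.image_of_continuousOn hc
  obtain ⟨K, hK⟩ := hg.locallyLipschitzOn.exists_lipschitzOnWith_of_compact hS
  exact lipschitz_comp hK hf (mapsTo_image _ _)

lemma const {X : Type*} [PseudoMetricSpace X] (c : X) (a b : ℝ) :
    AbsolutelyContinuousOnInterval (fun _ => c) a b :=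
  (LipschitzWith.const c).lipschitzOnWith.absolutelyContinuousOnInterval (K := 0)

lemma congr {X : Type*} [PseudoMetricSpace X] {f g : ℝ → X} {a b : ℝ}
    (hf : AbsolutelyContinuousOnInterval f a b) (h : EqOn f g (uIcc a b)) :
    AbsolutelyContinuousOnInterval g a b := by
  rw [absolutelyContinuousOnInterval_iff] at hf ⊢
  intro ε hε
  obtain ⟨δ, hδ, H⟩ := hf ε hε
  refine ⟨δ, hδ, fun E hE hEδ => ?_⟩
  refine lt_of_eq_of_lt (Finset.sum_congr rfl fun i hi => ?_) (H E hE hEδ)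
  rw [h (hE.1 i hi).1, h (hE.1 i hi).2]

lemma finset_sum {ι : Type*} {f : ι → ℝ → ℝ} {a b : ℝ} (S : Finset ι)
    (h : ∀ i ∈ S, AbsolutelyContinuousOnInterval (f i) a b) :
    AbsolutelyContinuousOnInterval (fun t => ∑ i ∈ S, f i t) a b := by
  classical
  induction S using Finset.induction_on with
  | empty => simpa using const 0 a b
  | insert i S hi ih =>
    simp only [Finset.sum_insert hi]
    exact (h i (by simp)).fun_add (ih fun j hj => h j (by simp [hj]))

lemma sup {f g : ℝ → ℝ} {a b : ℝ} (hf : AbsolutelyContinuousOnInterval f a b)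
    (hg : AbsolutelyContinuousOnInterval g a b) :
    AbsolutelyContinuousOnInterval (fun t => max (f t) (g t)) a b := by
  -- Uses `max f g = (f + g + |f - g|) / 2`.
  have habs : AbsolutelyContinuousOnInterval (fun t => |f t - g t|) a b :=
    lipschitz_comp (g := fun r : ℝ => |r|) (S := univ) (K := 1)
      (LipschitzWith.of_dist_le_mul fun x y => by
        simpa [Real.dist_eq] using abs_abs_sub_abs_le_abs_sub x y).lipschitzOnWith
      (hf.fun_sub hg) (mapsTo_univ _ _)
  refine (((hf.fun_add hg).fun_add habs).const_mul 2⁻¹).congr fun t _ => ?_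
  rcases le_total (f t) (g t) with h | h
  · simp only [max_eq_right h, abs_of_nonpos (sub_nonpos.2 h)]; ring
  · simp only [max_eq_left h, abs_of_nonneg (sub_nonneg.2 h)]; ring

/-- An absolutely continuous function whose derivative is a.e. at most `M` grows at rate `M`. -/
lemma sub_le_mul {f : ℝ → ℝ} {a b M : ℝ} (hab : a ≤ b) (hf : AbsolutelyContinuousOnInterval f a b)
    (h : ∀ᵐ t, t ∈ Ioo a b → ∀ d, HasDerivAt f d t → d ≤ M) : f b - f a ≤ M * (b - a) := by
  rw [← hf.integral_deriv_eq_sub]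
  have hc : ∫ _ in a..b, M = M * (b - a) := by simp [mul_comm]
  rw [← hc]
  refine intervalIntegral.integral_mono_ae_restrict hab hf.intervalIntegrable_deriv
    intervalIntegrable_const ?_
  rw [← Measure.restrict_congr_set Ioo_ae_eq_Icc, EventuallyLE, ae_restrict_iff' measurableSet_Ioo]
  filter_upwards [h, hf.ae_differentiableAt] with t h1 h2 ht
  exact h1 ht _ (h2 (Ioo_subset_Icc_self.trans Icc_subset_uIcc ht)).hasDerivAt

end AbsolutelyContinuousOnInterval

/-! ### Derivatives along curves -/

/-- The derivative of a maximum is the derivative of an active function. -/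
lemma HasDerivAt.max_cases {f g : ℝ → ℝ} {f' g' m t : ℝ} (hf : HasDerivAt f f' t)
    (hg : HasDerivAt g g' t) (hm : HasDerivAt (fun s => max (f s) (g s)) m t) :
    (g t ≤ f t ∧ m = f') ∨ (f t ≤ g t ∧ m = g') := by
  have key {k : ℝ → ℝ} {k' : ℝ} (hk : HasDerivAt k k' t) (hle : ∀ s, k s ≤ max (f s) (g s))
      (heq : k t = max (f t) (g t)) : m = k' := by
    -- The maximum minus an active branch is nonnegative and vanishes at `t`, so its derivative
    -- there is zero.
    have hmin : IsLocalMin (fun s => max (f s) (g s) - k s) t :=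
      Eventually.of_forall fun s => by
        simp only [heq, sub_self]; exact sub_nonneg.2 (hle s)
    have := hmin.hasDerivAt_eq_zero (hm.sub hk)
    linarith
  rcases le_total (g t) (f t) with h | h
  · exact .inl ⟨h, key hf (fun s => le_max_left _ _) (max_eq_left h).symm⟩
  · exact .inr ⟨h, key hg (fun s => le_max_right _ _) (max_eq_right h).symm⟩

section Clarke

variable {E : Type*} [NormedAddCommGroup E] [NormedSpace ℝ E] [FiniteDimensional ℝ E]
  [MeasurableSpace E] [BorelSpace E] (μ : Measure E) [μ.IsAddHaarMeasure]

/-- Almost every line in a given direction meets a set of full measure in a set of full measure. -/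
lemma ae_ae_add_smul {p : E → Prop} (hp : ∀ᵐ z ∂μ, p z) (v : E) :
    ∀ᵐ y ∂μ, ∀ᵐ s : ℝ, p (y + s • v) := by
  -- The good set is shrunk to a measurable set of full measure, so that Fubini applies. For each
  -- fixed `s`, translation by `s • v` preserves the measure.
  set S : Set E := (toMeasurable μ {z | ¬p z})ᶜ with hS
  have hSm : MeasurableSet S := (measurableSet_toMeasurable _ _).compl
  have hSae : ∀ᵐ z ∂μ, z ∈ S := by
    rw [ae_iff]
    simp only [hS, mem_compl_iff, not_not, ofPred_mem_eq]
    rw [measure_toMeasurable]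
    exact hp
  have hSp : ∀ z ∈ S, p z := fun z hz => by
    by_contra hn
    exact hz (subset_toMeasurable _ _ hn)
  have hmeas : MeasurableSet {q : E × ℝ | q.1 + q.2 • v ∈ S} :=
    (by fun_prop : Measurable fun q : E × ℝ => q.1 + q.2 • v) hSm
  have h1 : ∀ᵐ y ∂μ, ∀ᵐ s : ℝ, y + s • v ∈ S := by
    rw [Measure.ae_ae_comm hmeas]
    refine Eventually.of_forall fun s => ?_
    exact (measurePreserving_add_right μ (s • v)).quasiMeasurePreserving.ae hSae
  filter_upwards [h1] with y hy
  filter_upwards [hy] with s hs using hSp _ hs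

/-- A Lipschitz function whose derivative in the direction `v` is a.e. at most `M` grows at most
at rate `M` along segments in the direction `v`. -/
lemma LipschitzOnWith.sub_le_of_ae_fderiv_le {V : E → ℝ} {U : Set E} {K : NNReal}
    (hU : IsOpen U) (hV : LipschitzOnWith K V U) {v : E} {M : ℝ}
    (h : ∀ᵐ z ∂μ, z ∈ U → fderiv ℝ V z v ≤ M) {x : E} {τ : ℝ} (hτ : 0 ≤ τ)
    (hx : ∀ s ∈ Icc 0 τ, x + s • v ∈ U) : V (x + τ • v) - V x ≤ M * τ := by
  have hdiff : ∀ᵐ z ∂μ, z ∈ U → DifferentiableAt ℝ V z := by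
    filter_upwards [hV.ae_differentiableWithinAt_of_mem (μ := μ)] with z hz hzU
    exact (hz hzU).differentiableAt (hU.mem_nhds hzU)
  have hline := ae_ae_add_smul μ (hdiff.and h) v
  -- points near `x` whose segment stays in `U`
  have hnear : ∀ᶠ y in 𝓝 x, ∀ s ∈ Icc 0 τ, y + s • v ∈ U := by
    refine isCompact_Icc.eventually_forall_of_forall_eventually fun s hs => ?_
    have hc : Continuous fun z : E × ℝ => z.1 + z.2 • v := by fun_prop
    exact hc.continuousAt.eventually_mem (hU.mem_nhds (hx s hs))
  have hgood : ∀ᵐ y ∂μ, (∀ s ∈ Icc 0 τ, y + s • v ∈ U) → V (y + τ • v) - V y ≤ M * τ := by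
    filter_upwards [hline] with y hy hyU
    have hLip : LipschitzOnWith (K * ‖v‖₊) (fun s : ℝ => V (y + s • v)) (uIcc 0 τ) := by
      refine LipschitzOnWith.of_dist_le_mul fun s hs t ht => ?_
      rw [uIcc_of_le hτ] at hs ht
      refine (hV.dist_le_mul _ (hyU s hs) _ (hyU t ht)).trans_eq ?_
      rw [dist_add_left, dist_eq_norm, ← sub_smul, norm_smul, Real.dist_eq, Real.norm_eq_abs]
      push_cast
      ring
    have := hLip.absolutelyContinuousOnInterval.sub_le_mul (M := M) hτ (by
      filter_upwards [hy] with s hs hsI d hd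
      have hsU := hyU s (Ioo_subset_Icc_self hsI)
      have hc : HasDerivAt (fun s : ℝ => y + s • v) v s := by
        simpa using ((hasDerivAt_id s).smul_const v).const_add y
      have := (hs.1 hsU).hasFDerivAt.comp_hasDerivAt s hc
      rw [hd.unique this]
      exact hs.2 hsU)
    simpa using this
  -- The bound is known for almost every base point near `x`. Its failure at `x` would be an open
  -- condition, hence would hold on a set of positive measure.
  by_contra! hlt
  have hcont : ∀ᶠ y in 𝓝 x, M * τ < V (y + τ • v) - V y := by
    have hcV : ContinuousOn V U := hV.continuousOn
    have h0 : ContinuousAt V x :=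
      hcV.continuousAt (hU.mem_nhds (by simpa using hx 0 ⟨le_rfl, hτ⟩))
    have h1 : ContinuousAt (fun y => V (y + τ • v)) x :=
      ContinuousAt.comp (f := fun y => y + τ • v)
        (hcV.continuousAt (hU.mem_nhds (hx τ ⟨hτ, le_rfl⟩))) (by fun_prop)
    exact (h1.sub h0).eventually_const_lt hlt
  have hpos : μ {y | M * τ < V (y + τ • v) - V y ∧ ∀ s ∈ Icc 0 τ, y + s • v ∈ U} ≠ 0 :=
    (Measure.measure_pos_of_mem_nhds μ (hcont.and hnear)).ne'
  refine hpos (measure_mono_null (fun y hy => ?_) hgood)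
  simp only [mem_compl_iff, mem_ofPred_eq, not_forall, not_le]
  exact ⟨hy.2, hy.1⟩

/-- If the derivative of a locally Lipschitz function `V` along a continuous vector field `F` is
almost everywhere at most the continuous function `g`, this is so along every curve at which it
exists. -/
theorem LocallyLipschitz.deriv_le_of_ae_fderiv_le {V g : E → ℝ} {F : E → E}
    (hV : LocallyLipschitz V) (hF : Continuous F) (hg : Continuous g)
    (h : ∀ᵐ z ∂μ, fderiv ℝ V z (F z) ≤ g z) {c : ℝ → E} {t d : ℝ}
    (hc : HasDerivAt c (F (c t)) t) (hd : HasDerivAt (fun s => V (c s)) d t) : d ≤ g (c t) := by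
  set x := c t with hx
  set v := F x with hv
  refine le_of_forall_pos_le_add fun ε hε => ?_
  obtain ⟨K, S, hS, hK⟩ := hV x
  have hnear : ∀ᶠ z in 𝓝 x, g z + K * ‖F z - v‖ < g x + ε := by
    have : ContinuousAt (fun z => g z + K * ‖F z - v‖) x := by fun_prop
    refine this.eventually_lt_const ?_
    simp [hv, hε]
  obtain ⟨r, hr, hball⟩ := Metric.mem_nhds_iff.1 (inter_mem hS hnear)
  set U := Metric.ball x r with hU
  have hUS : U ⊆ S := fun z hz => (hball hz).1
  have hKU : LipschitzOnWith K V U := hK.mono hUS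
  have hM : ∀ᵐ z ∂μ, z ∈ U → fderiv ℝ V z v ≤ g x + ε := by
    filter_upwards [h] with z hz hzU
    -- The inequality along `F` becomes one along the constant direction `v = F x`: the Lipschitz
    -- constant bounds the derivative, and `F z` is close to `v` near `x`.
    have h1 : ‖fderiv ℝ V z‖ ≤ K :=
      norm_fderiv_le_of_lipschitzOn ℝ (Metric.isOpen_ball.mem_nhds hzU) hKU
    have h2 : fderiv ℝ V z v = fderiv ℝ V z (F z) - fderiv ℝ V z (F z - v) := by
      rw [← map_sub, sub_sub_cancel]
    have h3 : -fderiv ℝ V z (F z - v) ≤ K * ‖F z - v‖ := by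
      refine (neg_le_abs _).trans ?_
      rw [← Real.norm_eq_abs]
      exact (ContinuousLinearMap.le_opNorm _ _).trans
        (mul_le_mul_of_nonneg_right h1 (norm_nonneg _))
    have h4 : g z + K * ‖F z - v‖ < g x + ε := (hball hzU).2
    linarith
  -- compare the curve with its tangent
  have hlim1 : Tendsto (fun s : ℝ => s⁻¹ • (V (c (t + s)) - V x)) (𝓝[>] 0) (𝓝 d) := by
    have := hd.tendsto_slope_zero_right
    exact this
  have hlim2 : Tendsto (fun s : ℝ => g x + ε + K * ‖s⁻¹ • (c (t + s) - c t) - v‖) (𝓝[>] 0)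
      (𝓝 (g x + ε + K * ‖v - v‖)) :=
    tendsto_const_nhds.add (((hc.tendsto_slope_zero_right).sub_const v).norm.const_mul _)
  rw [sub_self, norm_zero, mul_zero, add_zero] at hlim2
  refine le_of_tendsto_of_tendsto hlim1 hlim2 ?_
  have hxU : x ∈ U := Metric.mem_ball_self hr
  have e1 : ∀ᶠ s : ℝ in 𝓝 0, c (t + s) ∈ U := by
    have : ContinuousAt (fun s : ℝ => c (t + s)) 0 :=
      ContinuousAt.comp (f := fun s : ℝ => t + s) (by simpa using hc.continuousAt) (by fun_prop)
    refine this.eventually_mem (Metric.isOpen_ball.mem_nhds ?_)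
    simpa [← hx] using hr
  have e2 : ∀ᶠ s : ℝ in 𝓝 0, |s| * ‖v‖ < r := by
    have : ContinuousAt (fun s : ℝ => |s| * ‖v‖) 0 := by fun_prop
    exact this.eventually_lt_const (by simpa using hr)
  filter_upwards [nhdsWithin_le_nhds e1, nhdsWithin_le_nhds e2, self_mem_nhdsWithin]
    with s h1 h2 hs
  have hs0 : (0 : ℝ) < s := hs
  have hseg : ∀ σ ∈ Icc 0 s, x + σ • v ∈ U := by
    intro σ hσ
    rw [hU, Metric.mem_ball, dist_self_add_left, norm_smul, Real.norm_of_nonneg hσ.1]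
    rw [abs_of_pos hs0] at h2
    exact (mul_le_mul_of_nonneg_right hσ.2 (norm_nonneg _)).trans_lt h2
  have h3 := hKU.sub_le_of_ae_fderiv_le μ Metric.isOpen_ball hM hs0.le hseg
  have h4 := (le_abs_self _).trans
    ((Real.dist_eq _ _).symm.trans_le (hKU.dist_le_mul _ h1 _ (hseg s ⟨hs0.le, le_rfl⟩)))
  have h5 : dist (c (t + s)) (x + s • v) = s * ‖s⁻¹ • (c (t + s) - c t) - v‖ := by
    rw [dist_eq_norm, ← Real.norm_of_nonneg hs0.le, ← norm_smul, Real.norm_of_nonneg hs0.le,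
      smul_sub, smul_smul, mul_inv_cancel₀ hs0.ne', one_smul, hx]
    congr 1
    abel
  rw [h5] at h4
  rw [smul_eq_mul, inv_mul_le_iff₀ hs0]
  nlinarith

end Clarke

/-! ### Decay along hybrid arcs -/

/-- Where an absolutely continuous function above the level `c` decays at rate `α`, its rescaling
decays exponentially. -/
lemma exp_mul_rescaling_sub_le {α ρ ρ' u : ℝ → ℝ} {s t c : ℝ} (hρ : IsClassKInf ρ)
    (hρ'_cont : ContinuousOn ρ' (Ioi 0))
    (hρ' : ∀ r, 0 < r → HasDerivAt ρ (ρ' r) r ∧ 0 ≤ ρ' r ∧ ρ r ≤ ρ' r * α r)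
    (hc : 0 < c) (hst : s ≤ t) (hu : AbsolutelyContinuousOnInterval u s t)
    (h : ∀ᵐ r, r ∈ Ioo s t → ∀ d, HasDerivAt u d r → c < u r → d ≤ -α (u r)) :
    Real.exp t * (ρ (max (u t) c) - ρ c) ≤ Real.exp s * (ρ (max (u s) c) - ρ c) := by
  -- `ρ` need not be Lipschitz near zero. Cutting `u` off below at the positive level `c` keeps it
  -- in a compact interval `[c, M]` on which `ρ` is Lipschitz, so that the composition stays
  -- absolutely continuous.
  have hmax : AbsolutelyContinuousOnInterval (fun r => max (u r) c) s t :=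
    hu.sup (AbsolutelyContinuousOnInterval.const c s t)
  obtain ⟨M, hM⟩ := hmax.exists_bound
  have hIcc : MapsTo (fun r => max (u r) c) (uIcc s t) (Icc c M) := fun r hr =>
    ⟨le_max_right _ _, (le_abs_self _).trans (hM r hr)⟩
  have hsub : Icc c M ⊆ Ioi 0 := fun r hr => hc.trans_le hr.1
  obtain ⟨L, hL⟩ := isCompact_Icc.exists_bound_of_continuousOn (hρ'_cont.mono hsub)
  have hLip : LipschitzOnWith (Real.toNNReal L) ρ (Icc c M) :=
    (convex_Icc c M).lipschitzOnWith_of_nnnorm_hasDerivWithin_le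
      (fun r hr => (hρ' r (hsub hr)).1.hasDerivWithinAt)
      fun r hr => NNReal.le_toNNReal_of_coe_le (hL r hr)
  have hac : AbsolutelyContinuousOnInterval
      (fun r => Real.exp r * (ρ (max (u r) c) - ρ c)) s t := by
    refine AbsolutelyContinuousOnInterval.fun_mul ?_ ((AbsolutelyContinuousOnInterval.lipschitz_comp hLip hmax hIcc).fun_sub
      (AbsolutelyContinuousOnInterval.const _ s t))
    exact Real.contDiff_exp.contDiffOn.absolutelyContinuousOnInterval
  have hnonneg (r : ℝ) : 0 ≤ ρ (max (u r) c) - ρ c :=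
    sub_nonneg.2 (hρ.le_of_le hc.le (le_max_right _ _))
  have := hac.sub_le_mul (M := 0) hst ?_
  · linarith
  filter_upwards [h, hu.ae_differentiableAt] with r hr hdiff hrI d hd
  have hur := (hdiff (Ioo_subset_Icc_self.trans Icc_subset_uIcc hrI)).hasDerivAt
  rcases le_or_gt (u r) c with hle | hlt
  · refine le_of_eq (IsLocalMin.hasDerivAt_eq_zero (Eventually.of_forall fun y => ?_) hd)
    simp only [max_eq_right hle, sub_self, mul_zero]
    exact mul_nonneg (Real.exp_pos _).le (hnonneg y)
  · have hur0 : 0 < u r := hc.trans hlt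
    have hd' : HasDerivAt (fun r => Real.exp r * (ρ (max (u r) c) - ρ c))
        (Real.exp r * (ρ (u r) - ρ c) + Real.exp r * (ρ' (u r) * deriv u r)) r := by
      have h1 : HasDerivAt (fun r => ρ (u r) - ρ c) (ρ' (u r) * deriv u r) r :=
        ((hρ' _ hur0).1.comp r hur).sub_const _
      refine ((Real.hasDerivAt_exp r).mul h1).congr_of_eventuallyEq ?_
      filter_upwards [hur.continuousAt.eventually_const_lt hlt] with y hy
      rw [max_eq_left hy.le]; rfl
    rw [hd.unique hd']
    have h1 := mul_le_mul_of_nonneg_left (hr hrI _ hur hlt) (hρ' _ hur0).2.1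
    have h2 := (hρ' _ hur0).2.2
    have h3 := hρ.nonneg hc.le
    rw [← mul_add]
    exact mul_nonpos_of_nonneg_of_nonpos (Real.exp_pos _).le (by linarith)

/-! ### Hybrid time domains and signal norms -/

namespace IsHybridTimeDomain

variable {E : Set (ℝ × ℕ)}

lemma zero_mem (hE : IsHybridTimeDomain E) : ((0 : ℝ), 0) ∈ E := by
  obtain ⟨⟨⟨t, j⟩, hp⟩, hnonneg, h⟩ := hE
  obtain ⟨n, τ, h0, hmono, hEq⟩ := h _ hp
  have hmem : (t, j) ∈ E ∩ Icc 0 t ×ˢ Iic j :=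
    ⟨hp, ⟨hnonneg _ hp, le_rfl⟩, mem_Iic.2 le_rfl⟩
  rw [hEq] at hmem
  simp only [mem_iUnion, mem_prod, mem_singleton_iff] at hmem
  obtain ⟨k, hk, -, rfl⟩ := hmem
  have h00 : ((0 : ℝ), 0) ∈ ⋃ j ∈ {j : ℕ | j < n}, Icc (τ j) (τ (j + 1)) ×ˢ {j} := by
    simp only [mem_iUnion, mem_prod, mem_singleton_iff]
    exact ⟨0, lt_of_le_of_lt (Nat.zero_le _) hk, ⟨h0.le, h0 ▸ hmono (Nat.zero_le 1)⟩, rfl⟩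
  rw [← hEq] at h00
  exact h00.1

/-- Induction along a hybrid time domain, over flows and jumps. -/
lemma induction (hE : IsHybridTimeDomain E) {C : ℝ → ℕ → Prop} (h0 : C 0 0)
    (hflow : ∀ j s t, s ≤ t → Icc s t ⊆ hybridSlice E j → C s j → C t j)
    (hjump : ∀ t j, (t, j) ∈ E → (t, j + 1) ∈ E → C t j → C t (j + 1)) {t : ℝ} {j : ℕ}
    (hp : (t, j) ∈ E) : C t j := by
  obtain ⟨n, τ, hτ0, hmono, hEq⟩ := hE.2.2 _ hp
  have hmem : (t, j) ∈ E ∩ Icc 0 t ×ˢ Iic j := ⟨hp, ⟨hE.2.1 _ hp, le_rfl⟩, mem_Iic.2 le_rfl⟩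
  rw [hEq] at hmem
  simp only [mem_iUnion, mem_prod, mem_singleton_iff] at hmem
  obtain ⟨k, hk, ht, rfl⟩ := hmem
  have hin {i : ℕ} (hi : i < n) {r : ℝ} (hr : r ∈ Icc (τ i) (τ (i + 1))) : (r, i) ∈ E := by
    have : (r, i) ∈ ⋃ j ∈ {j : ℕ | j < n}, Icc (τ j) (τ (j + 1)) ×ˢ {j} := by
      simp only [mem_iUnion, mem_prod, mem_singleton_iff]
      exact ⟨i, hi, hr, rfl⟩
    rw [← hEq] at this
    exact this.1
  have hk' : j < n := hk
  have key : ∀ i, i ≤ j → C (τ i) i := by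
    intro i
    induction i with
    | zero => intro _; rwa [hτ0]
    | succ i ih =>
      intro hi
      have hin' := hmono (Nat.le_succ i)
      refine hjump _ _ (hin (by omega) ⟨hin', le_rfl⟩)
        (hin (by omega) ⟨le_rfl, hmono (Nat.le_succ _)⟩) ?_
      exact hflow i _ _ hin' (fun r hr => hin (by omega) hr) (ih (by omega))
  exact hflow j _ _ ht.1 (fun r hr => hin hk' ⟨hr.1, hr.2.trans ht.2⟩) (key j le_rfl)

end IsHybridTimeDomain

lemma hybridSupNorm_ae_le {F : Type*} [NormedAddCommGroup F] {E : Set (ℝ × ℕ)} {w : ℝ → ℕ → F}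
    (hw : hybridSupNorm E w ≠ ∞) (j : ℕ) :
    ∀ᵐ t ∂(volume.restrict (hybridSlice E j)), ‖w t j‖ ≤ (hybridSupNorm E w).toReal := by
  filter_upwards [ae_le_eLpNormEssSup (f := fun t => w t j)
    (μ := volume.restrict (hybridSlice E j))] with t ht
  have h1 : ‖w t j‖ₑ ≤ hybridSupNorm E w :=
    ht.trans ((le_iSup (fun j => eLpNormEssSup (fun t => w t j)
      (volume.restrict (hybridSlice E j))) j).trans le_sup_left)
  rw [← toReal_enorm]
  exact ENNReal.toReal_mono hw h1

namespace NCS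

variable {N np nc ny nu nw : ℕ} (P : NCS N np nc ny nu nw)

/-! ### Regularity of the closed loop -/

lemma contDiff_xp : ContDiff ℝ 1 P.xp :=
  (PiLp.contDiff_toLp (𝕜 := ℝ) (p := 2)).comp (contDiff_pi.2 fun a => by fun_prop)

lemma contDiff_xc : ContDiff ℝ 1 P.xc :=
  (PiLp.contDiff_toLp (𝕜 := ℝ) (p := 2)).comp (contDiff_pi.2 fun a => by fun_prop)

lemma contDiff_gv (i : Fin N) : ContDiff ℝ 1 (P.gv i) := by
  refine (PiLp.contDiff_toLp (𝕜 := ℝ) (p := 2)).comp (contDiff_pi.2 fun a => ?_)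
  rcases P.part ⟨i, a⟩ with b | b
  · have := P.gp_smooth.comp P.contDiff_xp
    simp only [Sum.elim_inl]
    exact (contDiff_euclidean.1 this) b
  · have := P.gc_smooth.comp P.contDiff_xc
    simp only [Sum.elim_inr]
    exact (contDiff_euclidean.1 this) b

lemma gv_zero (i : Fin N) : P.gv i 0 = 0 := by
  have h1 : P.xp 0 = 0 := by ext; simp [xp]
  have h2 : P.xc 0 = 0 := by ext; simp [xc]
  ext a
  simp only [gv, h1, h2, P.gp_zero, P.gc_zero]
  rcases P.part ⟨i, a⟩ with b | b <;> simp

lemma continuous_ey : Continuous P.ey :=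
  (PiLp.continuous_toLp 2 _).comp (continuous_pi fun b => by fun_prop)

lemma continuous_eu : Continuous P.eu :=
  (PiLp.continuous_toLp 2 _).comp (continuous_pi fun b => by fun_prop)

lemma continuous_f : Continuous fun p : P.X × P.Err × P.Dist => P.f p.1 p.2.1 p.2.2 := by
  have hxp := P.contDiff_xp.continuous
  have hxc := P.contDiff_xc.continuous
  have hgp := P.gp_smooth.continuous
  have hgc := P.gc_smooth.continuous
  have hey := P.continuous_ey
  have heu := P.continuous_eu
  refine (PiLp.continuous_toLp 2 _).comp (continuous_pi fun a => ?_)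
  rcases a with a | a
  · simp only [Sum.elim_inl]
    have : Continuous fun p : P.X × P.Err × P.Dist => P.fp (P.xp p.1) (P.gc (P.xc p.1) + P.eu p.2.1)
        (P.gp (P.xp p.1) + P.ey p.2.1) p.2.2 :=
      P.fp_cont.comp (f := fun p : P.X × P.Err × P.Dist => (P.xp p.1, P.gc (P.xc p.1) + P.eu p.2.1,
        P.gp (P.xp p.1) + P.ey p.2.1, p.2.2)) (by fun_prop)
    fun_prop
  · simp only [Sum.elim_inr]
    have : Continuous fun p : P.X × P.Err × P.Dist => P.fc (P.xc p.1)
        (P.gp (P.xp p.1) + P.ey p.2.1) :=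
      P.fc_cont.comp (f := fun p : P.X × P.Err × P.Dist => (P.xc p.1,
        P.gp (P.xp p.1) + P.ey p.2.1)) (by fun_prop)
    fun_prop

lemma continuous_f_x (e : P.Err) (w : P.Dist) : Continuous fun x => P.f x e w :=
  P.continuous_f.comp (f := fun x : P.X => (x, e, w)) (by fun_prop)

lemma continuous_fv_update (i : Fin N) (x : P.X) (e : P.Err) (w : P.Dist) :
    Continuous fun ε : P.Sig i => P.fv i x (Function.update e i ε) w := by
  have h : Continuous fun ε : P.Sig i => Function.update e i ε := continuous_const.update i continuous_id
  exact (fderiv ℝ (P.gv i) x).continuous.comp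
    (P.continuous_f.comp (f := fun ε : P.Sig i => (x, Function.update e i ε, w)) (by fun_prop))

variable {P}

lemma ErrorStorage.Valid.locallyLipschitz {A : P.ErrorStorage} (hA : NCS.ErrorStorage.Valid P A)
    (i : Fin N) (k : ℕ) {l : ℤ} {θ : P.Mem i} (h : P.Adm i l θ) :
    LocallyLipschitz (A.W i k l θ) := by
  intro ε
  obtain ⟨K, S, hS, hK⟩ := hA.lipschitz i k l h.1 h.2.1 (x := (θ, ε)) h
  refine ⟨K, (fun ε' => (θ, ε')) ⁻¹' S, ?_, fun a ha b hb => ?_⟩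
  · have : Tendsto (fun ε' : P.Sig i => (θ, ε')) (𝓝 ε) (𝓝[{p | P.Adm i l p.1}] (θ, ε)) :=
      tendsto_nhdsWithin_iff.2 ⟨(by fun_prop : Continuous fun ε' : P.Sig i => (θ, ε')).continuousAt,
        Eventually.of_forall fun _ => h⟩
    exact this hS
  · have := hK ha hb
    simpa [Prod.edist_eq] using this

lemma PlantStorage.Valid.locallyLipschitz_δ_gv {A : P.ErrorStorage} {B : P.PlantStorage}
    (hB : NCS.PlantStorage.Valid P A B) (i : Fin N) : LocallyLipschitz fun x => B.δ i (P.gv i x) :=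
  (hB.δ_lipschitz i).comp (P.contDiff_gv i).locallyLipschitz

/-! ### Distance to the target -/

/-- `‖(x, e, η)‖`. -/
def State.residual (q : P.State) : ℝ :=
  √(‖q.x‖ ^ 2 + ∑ i, ‖q.e i‖ ^ 2 + ∑ i, q.η i ^ 2)

lemma distTo_target {q : P.State} (hq : q ∈ P.stateSpace) : q.distTo P.target = q.residual := by
  have hleast : IsLeast ((fun r => q.dist r) '' P.target) q.residual := by
    constructor
    -- The nearest point keeps the other components of `q`. It stays in the state space because the
    -- constraints do not couple them to `x`, `e` or `η`.
    · refine ⟨{ q with x := 0, e := 0, η := 0 }, ⟨fun i => ⟨(hq i).1, (hq i).2.1, (hq i).2.2.1,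
        le_rfl⟩, rfl, rfl, rfl⟩, ?_⟩
      simp [State.dist, State.residual]
    · rintro _ ⟨r, ⟨-, hx, he, hη⟩, rfl⟩
      refine Real.sqrt_le_sqrt ?_
      simp only [hx, he, hη, Pi.zero_apply, sub_zero]
      have h1 : 0 ≤ ∑ i, ∑ j, ‖q.θ i j - r.θ i j‖ ^ 2 := by positivity
      have h2 : 0 ≤ ∑ i, ‖q.vs i - r.vs i‖ ^ 2 := by positivity
      have h3 : 0 ≤ ∑ i, (q.τ i - r.τ i) ^ 2 := by positivity
      have h4 : 0 ≤ ∑ i, ((q.kt i : ℝ) - r.kt i) ^ 2 := by positivity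
      have h5 : 0 ≤ ∑ i, ((q.ku i : ℝ) - r.ku i) ^ 2 := by positivity
      have h6 : 0 ≤ ∑ i, ((q.l i : ℝ) - r.l i) ^ 2 := by positivity
      have h7 : 0 ≤ ∑ i, ((q.m i : ℝ) - r.m i) ^ 2 := by positivity
      linarith
  exact hleast.csInf_eq

lemma State.residual_nonneg (q : P.State) : 0 ≤ q.residual := Real.sqrt_nonneg _

lemma State.norm_x_le_residual (q : P.State) : ‖q.x‖ ≤ q.residual :=
  Real.le_sqrt_of_sq_le (by
    have h1 : 0 ≤ ∑ i, ‖q.e i‖ ^ 2 := by positivity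
    have h2 : 0 ≤ ∑ i, q.η i ^ 2 := by positivity
    linarith)

lemma State.norm_e_le_residual (q : P.State) (i : Fin N) : ‖q.e i‖ ≤ q.residual :=
  Real.le_sqrt_of_sq_le (by
    have h1 := Finset.single_le_sum (f := fun i => ‖q.e i‖ ^ 2) (fun i _ => by positivity)
      (Finset.mem_univ i)
    have h2 : 0 ≤ ∑ i, q.η i ^ 2 := by positivity
    have h3 : 0 ≤ ‖q.x‖ ^ 2 := by positivity
    linarith)

lemma State.η_le_residual (q : P.State) (i : Fin N) : q.η i ≤ q.residual :=
  Real.le_sqrt_of_sq_le (by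
    have h1 := Finset.single_le_sum (f := fun i => q.η i ^ 2) (fun i _ => by positivity)
      (Finset.mem_univ i)
    have h2 : 0 ≤ ∑ i, ‖q.e i‖ ^ 2 := by positivity
    have h3 : 0 ≤ ‖q.x‖ ^ 2 := by positivity
    linarith)

lemma State.residual_le {q : P.State} (hη : ∀ i, 0 ≤ q.η i) :
    q.residual ≤ ‖q.x‖ + ∑ i, ‖q.e i‖ + ∑ i, q.η i := by
  have h1 : 0 ≤ ∑ i, ‖q.e i‖ := by positivity
  have h2 : 0 ≤ ∑ i, q.η i := Finset.sum_nonneg fun i _ => hη i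
  refine Real.sqrt_le_iff.2 ⟨by positivity, ?_⟩
  have h3 : ∑ i, ‖q.e i‖ ^ 2 ≤ (∑ i, ‖q.e i‖) ^ 2 :=
    Finset.sum_sq_le_sq_sum_of_nonneg fun i _ => norm_nonneg _
  have h4 : ∑ i, q.η i ^ 2 ≤ (∑ i, q.η i) ^ 2 :=
    Finset.sum_sq_le_sq_sum_of_nonneg fun i _ => hη i
  nlinarith [norm_nonneg q.x, mul_nonneg (norm_nonneg q.x) h1, mul_nonneg (norm_nonneg q.x) h2,
    mul_nonneg h1 h2]

/-! ### Counting jumps -/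

variable (P) in
/-- A quantity that is constant along flows, up to `2 t / T_m^i`, and grows at jumps. -/
def jumpCounter (i : Fin N) (q : P.State) : ℝ := -(2 / P.Tm i * min (q.τ i) (P.TM i)) - q.l i

lemma TM_pos (i : Fin N) : 0 < P.TM i := (P.Tm_pos i).trans_le (P.Tm_le i)

/-- Resetting a timer that has reached `T_m` gains at least two units. A transmission gives one of
them back through `l`, which the later update recovers; hence the factor `2` in the counter. -/
lemma jumpCounter_jump {T : P.Trigger} {i : Fin N} {q r : P.State} (h : r ∈ jumpMap T i q) :
    (∀ k ≠ i, P.jumpCounter k r = P.jumpCounter k q) ∧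
      P.jumpCounter i q + 1 ≤ P.jumpCounter i r := by
  obtain ⟨hq, h⟩ := h
  have hmin : min (q.τ i) (P.TM i) = q.τ i := min_eq_left hq.2.2
  have hτ : 2 ≤ 2 / P.Tm i * q.τ i := by
    rw [div_mul_eq_mul_div, le_div_iff₀ (P.Tm_pos i)]
    linarith [hq.2.1]
  have h0 : min 0 (P.TM i) = 0 := min_eq_left (TM_pos i).le
  rcases h with ⟨-, -, μ, -, rfl⟩ | ⟨-, -, rfl⟩ | ⟨-, μ, -, rfl⟩
  · refine ⟨fun k hk => by simp [jumpCounter, hk], ?_⟩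
    simp only [jumpCounter, Function.update_self, h0, hmin]
    push_cast
    linarith
  · refine ⟨fun k hk => by simp [jumpCounter, hk], ?_⟩
    simp only [jumpCounter, Function.update_self, h0, hmin]
    linarith
  · refine ⟨fun k hk => by simp [jumpCounter, hk], ?_⟩
    simp only [jumpCounter, Function.update_self, hmin]
    push_cast
    linarith

/-- The flow set constrains only the interior of a flow interval; the bound reaches the endpoints by
closure. The interval must be nondegenerate: at an isolated point of a slice a timer may exceed
`T_M`. -/
lemma IsSolution.τ_le {T : P.Trigger} {E : Set (ℝ × ℕ)} {q : ℝ → ℕ → P.State}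
    {w : ℝ → ℕ → P.Dist} (h : IsSolution T E q w) {j : ℕ} {s t : ℝ} (hst : s < t)
    (hI : Icc s t ⊆ hybridSlice E j) {r : ℝ} (hr : r ∈ Icc s t) (i : Fin N) :
    (q r j).τ i ≤ P.TM i := by
  have hs : s ∈ hybridSlice E j := hI ⟨le_rfl, hst.le⟩
  have hint : Ioo s t ⊆ interior (hybridSlice E j) :=
    interior_maximal (Ioo_subset_Icc_self.trans hI) isOpen_Ioo
  have hcl : closure (Ioo s t) ⊆ {r | (q s j).τ i + (r - s) ≤ P.TM i} := by
    refine closure_minimal (fun r hr => ?_) (isClosed_le (by fun_prop) (by fun_prop))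
    have := (h.flow_mem j r (hint hr)).2 i
    rw [h.flow_τ j s hs r (hI (Ioo_subset_Icc_self hr)) i] at this
    exact this.2
  rw [closure_Ioo hst.ne] at hcl
  rw [h.flow_τ j s hs r (hI hr) i]
  exact hcl hr

/-- The number of jumps is bounded by an affine function of the ordinary time. -/
lemma IsSolution.jumps_le {T : P.Trigger} {E : Set (ℝ × ℕ)} {q : ℝ → ℕ → P.State}
    {w : ℝ → ℕ → P.Dist} (h : IsSolution T E q w) {t : ℝ} {j : ℕ} (hp : (t, j) ∈ E) :
    (j : ℝ) ≤ (∑ i, 2 / P.Tm i) * t + ∑ i, (2 / P.Tm i * P.TM i + P.D i + 1) := by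
  have hcount : (j : ℝ) + ∑ i, P.jumpCounter i (q 0 0) ≤
      ∑ i, P.jumpCounter i (q t j) + (∑ i, 2 / P.Tm i) * t := by
    refine h.domain.induction (C := fun t j => (j : ℝ) + ∑ i, P.jumpCounter i (q 0 0) ≤
      ∑ i, P.jumpCounter i (q t j) + (∑ i, 2 / P.Tm i) * t) (by simp) ?_ ?_ hp
    · intro j s t hst hI hs
      rcases hst.eq_or_lt with rfl | hlt
      · exact hs
      have hkey : ∀ i, P.jumpCounter i (q s j) + 2 / P.Tm i * s =
          P.jumpCounter i (q t j) + 2 / P.Tm i * t := fun i => by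
        have hs' : s ∈ Icc s t := ⟨le_rfl, hst⟩
        have ht' : t ∈ Icc s t := ⟨hst, le_rfl⟩
        rw [jumpCounter, jumpCounter, min_eq_left (h.τ_le hlt hI hs' i),
          min_eq_left (h.τ_le hlt hI ht' i), h.flow_τ j s (hI hs') t (hI ht') i,
          (h.flow_const j s (hI hs') t (hI ht')).2.2.2.2.1]
        ring
      have := Finset.sum_congr rfl fun i (_ : i ∈ Finset.univ) => hkey i
      rw [Finset.sum_add_distrib, Finset.sum_add_distrib, ← Finset.sum_mul, ← Finset.sum_mul] at this
      linarith
    · intro t j h1 h2 hC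
      obtain ⟨i, hi⟩ := h.jump t j h1 h2
      obtain ⟨hne, heq⟩ := jumpCounter_jump hi
      have : ∑ k, P.jumpCounter k (q t j) + 1 ≤ ∑ k, P.jumpCounter k (q t (j + 1)) := by
        rw [← Finset.add_sum_erase _ _ (Finset.mem_univ i),
          ← Finset.add_sum_erase (a := i) _ (fun k => P.jumpCounter k (q t (j + 1)))
            (Finset.mem_univ i),
          Finset.sum_congr rfl fun k hk => hne k (Finset.ne_of_mem_erase hk)]
        linarith
      push_cast
      linarith
  -- The counter takes values in a bounded interval, because the timer is clamped to `[0, T_M]` and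
  -- `0 ≤ l ≤ D + 1`. This turns the growth estimate into a bound on `j`.
  have hup : ∑ i, P.jumpCounter i (q t j) ≤ 0 := Finset.sum_nonpos fun i _ => by
    have hq := h.mem t j hp i
    have h1 : (0 : ℝ) ≤ (q t j).l i := by exact_mod_cast hq.1.1
    have h2 : 0 ≤ 2 / P.Tm i * min ((q t j).τ i) (P.TM i) :=
      mul_nonneg (div_nonneg zero_le_two (P.Tm_pos i).le) (le_min hq.2.1 (TM_pos i).le)
    rw [jumpCounter]
    linarith
  have hlo : -∑ i, (2 / P.Tm i * P.TM i + P.D i + 1) ≤ ∑ i, P.jumpCounter i (q 0 0) := by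
    rw [← Finset.sum_neg_distrib]
    refine Finset.sum_le_sum fun i _ => ?_
    have hq := h.mem 0 0 h.domain.zero_mem i
    have h1 : ((q 0 0).l i : ℝ) ≤ P.D i + 1 := by exact_mod_cast hq.1.2.1
    have h2 : 2 / P.Tm i * min ((q 0 0).τ i) (P.TM i) ≤ 2 / P.Tm i * P.TM i :=
      mul_le_mul_of_nonneg_left (min_le_right _ _) (div_nonneg zero_le_two (P.Tm_pos i).le)
    rw [jumpCounter]
    linarith
  linarith

end NCS

namespace NCS

variable {N np nc ny nu nw : ℕ} {P : NCS N np nc ny nu nw}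

/-! ### The hybrid storage function -/

/-- The state space puts no upper bound on the timers, while `φ` is controlled only on `[0, T_M]`.
Clamping keeps the storage function meaningful on all of it. -/
lemma clamp_mem {q : P.State} (hq : q ∈ P.stateSpace) (i : Fin N) :
    min (q.τ i) (P.TM i) ∈ Icc 0 (P.TM i) :=
  ⟨le_min (hq i).2.1 (TM_pos i).le, min_le_right _ _⟩

variable (P) in
/-- The design conditions on the functions `φ_{l,i}` and on the event triggers. -/
structure DesignConditions (T : P.Trigger) (A : P.ErrorStorage) (B : P.PlantStorage)
    (φ : Fin N → ℤ → ℝ → ℝ) (a ε π ρbar ρhat φlow : Fin N → ℝ) : Prop where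
  errors : NCS.ErrorStorage.Valid P A
  plant : NCS.PlantStorage.Valid P A B
  φ_ode : ∀ (i : Fin N) (l : ℤ), 0 ≤ l → l ≤ P.D i + 1 → ∀ τ ∈ Icc 0 (P.TM i),
    HasDerivWithinAt (φ i l)
      (-2 * A.L i l * φ i l τ - B.γ i l * (φ i l τ ^ 2 + 1)) (Icc 0 (P.TM i)) τ
  update : ∀ (i : Fin N) (l : ℤ), 1 ≤ l → l ≤ P.D i + 1 → ∀ τ ∈ Icc 0 (P.TM i),
    B.γ i (l - 1) * φ i (l - 1) τ ≤ B.γ i l * φ i l τ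
  a_pos : ∀ i, 0 < a i
  ε_mem : ∀ i, ε i ∈ Ioo (0 : ℝ) 1
  π_mem : ∀ i, π i ∈ Ioo (0 : ℝ) 1
  φlow_pos : ∀ i, 0 < φlow i
  φlow_le : ∀ (i : Fin N) (l : ℤ), 0 ≤ l → l ≤ P.D i + 1 → ∀ τ ∈ Icc 0 (P.TM i), φlow i ≤ φ i l τ
  ρbar_nonneg : ∀ i, 0 ≤ ρbar i
  ρhat_nonneg : ∀ i, 0 ≤ ρhat i
  ρbar_le : ∀ (i : Fin N) (l : ℤ), 0 ≤ l → l ≤ P.D i + 1 → ρbar i ≤ B.ϵ i l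
  ρhat_le : ∀ i, ρhat i ≤ 1 / 2 * min 1 (φlow i / B.γmax i)
  fη_le : ∀ i, ∀ q ∈ P.flowSet,
    T.fη i q ≤ -a i * q.η i + B.δh i (P.gv i q.x + q.e i)
      + (1 - ε i) * P.rhoTilde π ρbar i * B.δ i (q.vs i)
  gt_le : ∀ i, ∀ q ∈ P.jumpSet i, q.l i ≤ P.D i →
    T.gt i q ≤ q.η i - ρbar i * B.δ i (P.gv i q.x)
      + ρbar i * max (B.δ i (P.gv i q.x)) (P.varpi π i (q.τ i) * B.δ i (q.vs i))
      - max (B.γ i (q.l i + 1) * φ i (q.l i + 1) 0 * A.lam i ^ 2 * A.Wq i q ^ 2)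
          (ρhat i * B.δ i (P.gv i q.x))
      + max (B.γ i (q.l i) * φ i (q.l i) (q.τ i) * A.Wq i q ^ 2)
          (ρhat i * B.δ i (P.gv i q.x))
  gs_le : ∀ i, ∀ q ∈ P.jumpSet i,
    T.gs i q ≤ q.η i - ρbar i * B.δ i (P.gv i q.x)
      + ρbar i * max (B.δ i (P.gv i q.x)) (P.varpi π i (q.τ i) * B.δ i (q.vs i))
      - max (B.γ i (q.l i) * φ i (q.l i) 0 * A.Wq i q ^ 2) (ρhat i * B.δ i (P.gv i q.x))
      + max (B.γ i (q.l i) * φ i (q.l i) (q.τ i) * A.Wq i q ^ 2)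
          (ρhat i * B.δ i (P.gv i q.x))

/-- Storage of channel `i`.  The timer is cut off at `T_M^i`. -/
def channelStorage (A : P.ErrorStorage) (B : P.PlantStorage) (φ : Fin N → ℤ → ℝ → ℝ)
    (π ρbar ρhat : Fin N → ℝ) (i : Fin N) (q : P.State) : ℝ :=
  q.η i
    + ρbar i * max (B.δ i (P.gv i q.x)) (P.varpi π i (min (q.τ i) (P.TM i)) * B.δ i (q.vs i))
    + max (B.γ i (q.l i) * φ i (q.l i) (min (q.τ i) (P.TM i)) * A.Wq i q ^ 2)
        (ρhat i * B.δ i (P.gv i q.x))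

/-- Storage of the whole system. -/
def storage (A : P.ErrorStorage) (B : P.PlantStorage) (φ : Fin N → ℤ → ℝ → ℝ)
    (π ρbar ρhat : Fin N → ℝ) (q : P.State) : ℝ :=
  B.V q.x + ∑ i, channelStorage A B φ π ρbar ρhat i q

open Classical in
/-- Dissipation that stems from the last sampled signal of channel `i`. -/
def sampleLoss (B : P.PlantStorage) (ε π ρbar : Fin N → ℝ) (i : Fin N) (q : P.State) : ℝ :=
  if B.δ i (P.gv i q.x) < P.varpi π i (min (q.τ i) (P.TM i)) * B.δ i (q.vs i) then
    ε i * ((1 - π i) / P.TM i) * (ρbar i * B.δ i (q.vs i)) else 0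

/-- Dissipation rate of `storage` along flows. -/
def dissipation (A : P.ErrorStorage) (B : P.PlantStorage) (a ε π ρbar : Fin N → ℝ)
    (q : P.State) : ℝ :=
  B.αV ‖q.x‖ + ∑ i, (a i * q.η i + B.σ i (q.l i) (A.Wq i q) + sampleLoss B ε π ρbar i q)

/-! ### Comparison of the storage function with its dissipation rate and with the distance to the
target -/

namespace DesignConditions

variable {T : P.Trigger} {A : P.ErrorStorage} {B : P.PlantStorage} {φ : Fin N → ℤ → ℝ → ℝ}
  {a ε π ρbar ρhat φlow : Fin N → ℝ} (h : DesignConditions P T A B φ a ε π ρbar ρhat φlow)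
include h

lemma δ_nonneg (i : Fin N) (ν : P.Sig i) : 0 ≤ B.δ i ν :=
  ((h.plant.βδlo_class i).nonneg (norm_nonneg ν)).trans (h.plant.δ_lower i ν)

lemma W_nonneg {q : P.State} (hq : q ∈ P.stateSpace) (i : Fin N) : 0 ≤ A.Wq i q :=
  ((h.errors.βlo_class i).nonneg (Real.sqrt_nonneg _)).trans
    (h.errors.lower i _ _ _ (hq i).1 _)

lemma φ_pos (i : Fin N) {l : ℤ} (h0 : 0 ≤ l) (h1 : l ≤ P.D i + 1) {τ : ℝ}
    (hτ : τ ∈ Icc 0 (P.TM i)) : 0 < φ i l τ :=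
  (h.φlow_pos i).trans_le (h.φlow_le i l h0 h1 τ hτ)

lemma varpi_mem (i : Fin N) {τ : ℝ} (hτ : τ ∈ Icc 0 (P.TM i)) :
    π i ≤ P.varpi π i τ ∧ P.varpi π i τ ≤ 1 := by
  have hT := TM_pos (P := P) i
  have h1 : 0 ≤ (1 - π i) / P.TM i := div_nonneg (by linarith [(h.π_mem i).2]) hT.le
  have h2 : (1 - π i) / P.TM i * τ ≤ 1 - π i := by
    calc (1 - π i) / P.TM i * τ ≤ (1 - π i) / P.TM i * P.TM i :=
          mul_le_mul_of_nonneg_left hτ.2 h1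
      _ = 1 - π i := div_mul_cancel₀ _ hT.ne'
  have h3 := mul_nonneg h1 hτ.1
  constructor <;> simp only [varpi] <;> linarith

lemma sampleLoss_nonneg (i : Fin N) (q : P.State) : 0 ≤ sampleLoss B ε π ρbar i q := by
  rw [sampleLoss]
  split_ifs
  · exact mul_nonneg (mul_nonneg (h.ε_mem i).1.le
      (div_nonneg (by linarith [(h.π_mem i).2]) (TM_pos i).le))
      (mul_nonneg (h.ρbar_nonneg i) (h.δ_nonneg i _))
  · exact le_rfl

lemma dissipation_term_nonneg {q : P.State} (hq : q ∈ P.stateSpace) (i : Fin N) :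
    0 ≤ a i * q.η i ∧ 0 ≤ B.σ i (q.l i) (A.Wq i q) ∧ 0 ≤ sampleLoss B ε π ρbar i q :=
  ⟨mul_nonneg (h.a_pos i).le (hq i).2.2.2,
    (h.plant.σ_class i _ (hq i).1.1 (hq i).1.2.1).nonneg (h.W_nonneg hq i),
    h.sampleLoss_nonneg i q⟩

lemma αV_le_dissipation {q : P.State} (hq : q ∈ P.stateSpace) :
    B.αV ‖q.x‖ ≤ dissipation A B a ε π ρbar q :=
  le_add_of_nonneg_right (Finset.sum_nonneg fun i _ => by
    have := h.dissipation_term_nonneg hq i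
    linarith)

lemma term_le_dissipation {q : P.State} (hq : q ∈ P.stateSpace) (i : Fin N) :
    a i * q.η i + B.σ i (q.l i) (A.Wq i q) + sampleLoss B ε π ρbar i q
      ≤ dissipation A B a ε π ρbar q := by
  have h1 := Finset.single_le_sum
    (f := fun i => a i * q.η i + B.σ i (q.l i) (A.Wq i q) + sampleLoss B ε π ρbar i q)
    (fun i _ => by have := h.dissipation_term_nonneg hq i; linarith) (Finset.mem_univ i)
  have h2 := h.plant.αV_class.nonneg (norm_nonneg q.x)
  rw [dissipation]
  linarith

lemma dissipation_nonneg {q : P.State} (hq : q ∈ P.stateSpace) :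
    0 ≤ dissipation A B a ε π ρbar q :=
  (h.plant.αV_class.nonneg (norm_nonneg q.x)).trans (h.αV_le_dissipation hq)

/-- `γ_{l,i} φ_{l,i}` is bounded, uniformly in `l`. -/
lemma exists_weight_bound (i : Fin N) : ∃ C, 0 ≤ C ∧ ∀ l : ℤ, 0 ≤ l → l ≤ P.D i + 1 →
    ∀ τ ∈ Icc 0 (P.TM i), B.γ i l * φ i l τ ≤ C := by
  -- Outside the range of `l` the constant is `0`, so that one can be chosen for every integer;
  -- their sum over the range serves all `l` at once.
  have hl (l : ℤ) : ∃ C, 0 ≤ C ∧ (0 ≤ l → l ≤ P.D i + 1 →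
      ∀ τ ∈ Icc 0 (P.TM i), B.γ i l * φ i l τ ≤ C) := by
    by_cases hl : 0 ≤ l ∧ l ≤ P.D i + 1
    · have hcont : ContinuousOn (fun τ => B.γ i l * φ i l τ) (Icc 0 (P.TM i)) :=
        continuousOn_const.mul fun τ hτ => (h.φ_ode i l hl.1 hl.2 τ hτ).continuousWithinAt
      obtain ⟨C, hC⟩ := isCompact_Icc.exists_bound_of_continuousOn hcont
      exact ⟨|C|, abs_nonneg C, fun _ _ τ hτ =>
        (le_abs_self _).trans ((hC τ hτ).trans (le_abs_self C))⟩
    · exact ⟨0, le_rfl, fun h0 h1 => absurd ⟨h0, h1⟩ hl⟩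
  choose C hC0 hC using hl
  refine ⟨∑ l ∈ Finset.Icc (0 : ℤ) (P.D i + 1), C l, Finset.sum_nonneg fun l _ => hC0 l,
    fun l h0 h1 τ hτ => (hC l h0 h1 τ hτ).trans ?_⟩
  exact Finset.single_le_sum (fun l _ => hC0 l) (Finset.mem_Icc.2 ⟨h0, h1⟩)

/-- `δ̃_i(v_i)` is bounded by a gain of `‖x‖`. -/
lemma exists_δ_gain (i : Fin N) : ∃ κ, IsGain κ ∧ ∀ x, B.δ i (P.gv i x) ≤ κ ‖x‖ :=
  IsGain.exists_of_continuous ((h.plant.δ_lipschitz i).continuous.comp (P.contDiff_gv i).continuous)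
    (by simp [gv_zero, h.plant.δ_zero])

/-- The storage function is bounded by a gain of its dissipation rate. -/
lemma exists_storage_le_gain_dissipation : ∃ κ, IsGain κ ∧ ∀ q ∈ P.stateSpace,
    storage A B φ π ρbar ρhat q ≤ κ (dissipation A B a ε π ρbar q) := by
  obtain ⟨αinv, hαinv, hαl, -⟩ := h.plant.αV_class.exists_inverse
  choose κδ hκδ hδ using h.exists_δ_gain
  choose C hC0 hC using h.exists_weight_bound
  -- The inverses of `σ` depend on `l`; their sum over the range of `l` is a single gain. Outside
  -- the range the default is the zero gain.
  have hσ (i : Fin N) (l : ℤ) : ∃ g, IsGain g ∧ (0 ≤ l → l ≤ P.D i + 1 →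
      ∀ s, 0 ≤ s → g (B.σ i l s) = s) := by
    by_cases hl : 0 ≤ l ∧ l ≤ P.D i + 1
    · obtain ⟨g, hg, hgl, -⟩ := (h.plant.σ_class i l hl.1 hl.2).exists_inverse
      exact ⟨g, hg.isGain, fun _ _ => hgl⟩
    · exact ⟨fun _ => 0, IsGain.zero, fun h0 h1 => absurd ⟨h0, h1⟩ hl⟩
  choose σinv hσinv hσl using hσ
  have hgx (i : Fin N) : IsGain fun s => κδ i (αinv s) := (hκδ i).comp hαinv.isGain
  have hgW (i : Fin N) : IsGain fun s => ∑ l ∈ Finset.Icc (0 : ℤ) (P.D i + 1), σinv i l s :=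
    IsGain.sum _ fun l _ => hσinv i l
  have hrate (i : Fin N) : 0 < ε i * ((1 - π i) / P.TM i) :=
    mul_pos (h.ε_mem i).1 (div_pos (by linarith [(h.π_mem i).2]) (TM_pos i))
  have hκi (i : Fin N) : IsGain fun s => (a i)⁻¹ * s
      + (ρbar i * κδ i (αinv s) + (ε i * ((1 - π i) / P.TM i))⁻¹ * s)
      + (C i * (∑ l ∈ Finset.Icc (0 : ℤ) (P.D i + 1), σinv i l s) ^ 2 + ρhat i * κδ i (αinv s)) :=
    ((IsGain.id.const_mul (inv_pos.2 (h.a_pos i)).le).add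
      (((hgx i).const_mul (h.ρbar_nonneg i)).add
        (IsGain.id.const_mul (inv_pos.2 (hrate i)).le))).add
      (((hgW i).sq.const_mul (hC0 i)).add ((hgx i).const_mul (h.ρhat_nonneg i)))
  refine ⟨_, (h.plant.βVhi_class.comp hαinv).isGain.add (IsGain.sum Finset.univ fun i _ => hκi i),
    fun q hq => ?_⟩
  set d := dissipation A B a ε π ρbar q with hd
  have hd0 : 0 ≤ d := h.dissipation_nonneg hq
  have hx : ‖q.x‖ ≤ αinv d := by
    rw [← hαl _ (norm_nonneg q.x)]
    exact hαinv.le_of_le (h.plant.αV_class.nonneg (norm_nonneg _)) (h.αV_le_dissipation hq)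
  have hδx (i : Fin N) : B.δ i (P.gv i q.x) ≤ κδ i (αinv d) :=
    (hδ i q.x).trans ((hκδ i).le_of_le (norm_nonneg _) hx)
  refine add_le_add ((h.plant.V_upper _).trans (h.plant.βVhi_class.le_of_le (norm_nonneg _) hx))
    (Finset.sum_le_sum fun i _ => ?_)
  have hterm := h.term_le_dissipation hq i
  obtain ⟨t1, t2, t3⟩ := h.dissipation_term_nonneg hq i
  rw [← hd] at hterm
  have hτ := clamp_mem hq i
  refine add_le_add (add_le_add ?_ ?_) ?_
  · rw [inv_mul_eq_div, le_div_iff₀ (h.a_pos i)]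
    linarith
  · have hk0 : 0 ≤ ρbar i * κδ i (αinv d) :=
      mul_nonneg (h.ρbar_nonneg i) ((hgx i).nonneg hd0)
    -- If the sampled value attains the maximum strictly, `sampleLoss` is switched on and controls
    -- it; otherwise the maximum is `δ(v)`, which is controlled by `‖x‖`.
    by_cases hlt : B.δ i (P.gv i q.x) < P.varpi π i (min (q.τ i) (P.TM i)) * B.δ i (q.vs i)
    · rw [max_eq_right hlt.le]
      have hs : sampleLoss B ε π ρbar i q =
        ε i * ((1 - π i) / P.TM i) * (ρbar i * B.δ i (q.vs i)) := if_pos hlt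
      have h1 : ρbar i * B.δ i (q.vs i) ≤ (ε i * ((1 - π i) / P.TM i))⁻¹ * d := by
        rw [inv_mul_eq_div, le_div_iff₀ (hrate i), mul_comm, ← hs]
        linarith
      have h2 : ρbar i * (P.varpi π i (min (q.τ i) (P.TM i)) * B.δ i (q.vs i))
          ≤ ρbar i * B.δ i (q.vs i) :=
        mul_le_mul_of_nonneg_left (mul_le_of_le_one_left (h.δ_nonneg i _) (h.varpi_mem i hτ).2)
          (h.ρbar_nonneg i)
      linarith
    · rw [max_eq_left (not_lt.1 hlt)]
      have h1 : 0 ≤ (ε i * ((1 - π i) / P.TM i))⁻¹ * d := mul_nonneg (inv_pos.2 (hrate i)).le hd0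
      have h2 := mul_le_mul_of_nonneg_left (hδx i) (h.ρbar_nonneg i)
      linarith
  · have hl := (hq i).1
    have hW0 := h.W_nonneg hq i
    have hW : A.Wq i q ≤ ∑ l ∈ Finset.Icc (0 : ℤ) (P.D i + 1), σinv i l d := by
      refine le_trans ?_ (IsGain.le_sum (k := σinv i) (fun l _ => hσinv i l)
        (Finset.mem_Icc.2 ⟨hl.1, hl.2.1⟩) hd0)
      conv_lhs => rw [← hσl i (q.l i) hl.1 hl.2.1 _ hW0]
      exact (hσinv i _).le_of_le t2 (by linarith)
    have h1 : B.γ i (q.l i) * φ i (q.l i) (min (q.τ i) (P.TM i)) * A.Wq i q ^ 2 ≤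
        C i * (∑ l ∈ Finset.Icc (0 : ℤ) (P.D i + 1), σinv i l d) ^ 2 :=
      mul_le_mul (hC i _ hl.1 hl.2.1 _ hτ) (pow_le_pow_left₀ hW0 hW 2) (sq_nonneg _) (hC0 i)
    have h2 : 0 ≤ C i * (∑ l ∈ Finset.Icc (0 : ℤ) (P.D i + 1), σinv i l d) ^ 2 :=
      mul_nonneg (hC0 i) (sq_nonneg _)
    have h3 := mul_le_mul_of_nonneg_left (hδx i) (h.ρhat_nonneg i)
    have h4 : 0 ≤ ρhat i * κδ i (αinv d) := mul_nonneg (h.ρhat_nonneg i) ((hgx i).nonneg hd0)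
    exact max_le (by linarith) (by linarith)

/-- The uniform lower bound on `φ` keeps a positive multiple of `W²` inside the storage, which is
how `e` is recovered from it. -/
lemma channelStorage_nonneg_terms {q : P.State} (hq : q ∈ P.stateSpace) (i : Fin N) :
    q.η i + B.γ i (q.l i) * φlow i * A.Wq i q ^ 2 ≤ channelStorage A B φ π ρbar ρhat i q := by
  have hl := (hq i).1
  have hγ := h.plant.γ_pos i _ hl.1 hl.2.1
  have h1 : 0 ≤ ρbar i * max (B.δ i (P.gv i q.x))
      (P.varpi π i (min (q.τ i) (P.TM i)) * B.δ i (q.vs i)) :=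
    mul_nonneg (h.ρbar_nonneg i) (le_max_of_le_left (h.δ_nonneg i _))
  have h2 : B.γ i (q.l i) * φlow i * A.Wq i q ^ 2 ≤
      max (B.γ i (q.l i) * φ i (q.l i) (min (q.τ i) (P.TM i)) * A.Wq i q ^ 2)
        (ρhat i * B.δ i (P.gv i q.x)) :=
    le_max_of_le_left (mul_le_mul_of_nonneg_right (mul_le_mul_of_nonneg_left
      (h.φlow_le i _ hl.1 hl.2.1 _ (clamp_mem hq i)) hγ.le) (sq_nonneg _))
  rw [channelStorage]
  linarith

lemma channelStorage_nonneg {q : P.State} (hq : q ∈ P.stateSpace) (i : Fin N) :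
    0 ≤ channelStorage A B φ π ρbar ρhat i q := by
  have h1 := h.channelStorage_nonneg_terms hq i
  have hγ := h.plant.γ_pos i _ (hq i).1.1 (hq i).1.2.1
  have := (h.φlow_pos i)
  have h2 : 0 ≤ B.γ i (q.l i) * φlow i * A.Wq i q ^ 2 := by positivity
  linarith [(hq i).2.2.2]

lemma V_nonneg (x : P.X) : 0 ≤ B.V x :=
  (h.plant.βVlo_class.nonneg (norm_nonneg x)).trans (h.plant.V_lower x)

lemma storage_nonneg {q : P.State} (hq : q ∈ P.stateSpace) :
    0 ≤ storage A B φ π ρbar ρhat q :=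
  add_nonneg (h.V_nonneg _) (Finset.sum_nonneg fun i _ => h.channelStorage_nonneg hq i)

lemma channelStorage_le_storage {q : P.State} (hq : q ∈ P.stateSpace) (i : Fin N) :
    channelStorage A B φ π ρbar ρhat i q ≤ storage A B φ π ρbar ρhat q := by
  have h1 := Finset.single_le_sum (f := fun i => channelStorage A B φ π ρbar ρhat i q)
    (fun i _ => h.channelStorage_nonneg hq i) (Finset.mem_univ i)
  have := h.V_nonneg q.x
  rw [storage]
  linarith

/-- The distance to the target is bounded by a gain of the storage function. -/
lemma exists_residual_le_gain_storage : ∃ κ, IsGain κ ∧ ∀ q ∈ P.stateSpace,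
    q.residual ≤ κ (storage A B φ π ρbar ρhat q) := by
  obtain ⟨Vinv, hVinv, hVl, -⟩ := h.plant.βVlo_class.exists_inverse
  choose Winv hWinv hWl _ using fun i => (h.errors.βlo_class i).exists_inverse
  have hγ (i : Fin N) (l : ℤ) : ∃ c : ℝ, 0 ≤ c ∧ (0 ≤ l → l ≤ P.D i + 1 →
      c = (B.γ i l * φlow i)⁻¹) := by
    by_cases hl : 0 ≤ l ∧ l ≤ P.D i + 1
    · exact ⟨_, (inv_pos.2 (mul_pos (h.plant.γ_pos i l hl.1 hl.2) (h.φlow_pos i))).le,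
        fun _ _ => rfl⟩
    · exact ⟨0, le_rfl, fun h0 h1 => absurd ⟨h0, h1⟩ hl⟩
  choose c hc0 hc using hγ
  have hCnn (i : Fin N) : 0 ≤ ∑ l ∈ Finset.Icc (0 : ℤ) (P.D i + 1), c i l :=
    Finset.sum_nonneg fun l _ => hc0 i l
  have hgW (i : Fin N) : IsGain fun s =>
      Winv i (√((∑ l ∈ Finset.Icc (0 : ℤ) (P.D i + 1), c i l) * s)) :=
    (hWinv i).isGain.comp (IsGain.sqrt.comp (IsGain.id.const_mul (hCnn i)))
  refine ⟨_, (hVinv.isGain.add (IsGain.sum Finset.univ fun i _ => hgW i)).add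
    (IsGain.sum (Finset.univ : Finset (Fin N)) fun i _ => IsGain.id), fun q hq => ?_⟩
  set u := storage A B φ π ρbar ρhat q with hu
  have hu0 : 0 ≤ u := h.storage_nonneg hq
  refine (State.residual_le fun i => (hq i).2.2.2).trans
    (add_le_add (add_le_add ?_ (Finset.sum_le_sum fun i _ => ?_))
      (Finset.sum_le_sum fun i _ => ?_))
  · rw [← hVl _ (norm_nonneg q.x)]
    refine hVinv.le_of_le (h.plant.βVlo_class.nonneg (norm_nonneg _))
      ((h.plant.V_lower _).trans ?_)
    exact le_add_of_nonneg_right (Finset.sum_nonneg fun i _ => h.channelStorage_nonneg hq i)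
  · have hl := (hq i).1
    have hγφ : 0 < B.γ i (q.l i) * φlow i :=
      mul_pos (h.plant.γ_pos i _ hl.1 hl.2.1) (h.φlow_pos i)
    rw [← hWl i _ (norm_nonneg (q.e i))]
    refine (hWinv i).le_of_le ((h.errors.βlo_class i).nonneg (norm_nonneg _)) ?_
    have h1 : ‖q.e i‖ ≤ P.errNorm (q.e i) (q.θ i) :=
      Real.le_sqrt_of_sq_le (le_add_of_nonneg_right (by positivity))
    refine (((h.errors.βlo_class i).le_of_le (norm_nonneg _) h1).trans
      (h.errors.lower i (q.kt i) _ _ hl (q.e i))).trans (Real.le_sqrt_of_sq_le ?_)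
    have h2 := (h.channelStorage_nonneg_terms hq i).trans (h.channelStorage_le_storage hq i)
    have h3 : A.Wq i q ^ 2 ≤ (B.γ i (q.l i) * φlow i)⁻¹ * u := by
      rw [inv_mul_eq_div, le_div_iff₀ hγφ]
      linarith [(hq i).2.2.2]
    refine h3.trans (mul_le_mul_of_nonneg_right ?_ hu0)
    rw [← hc i _ hl.1 hl.2.1]
    exact Finset.single_le_sum (f := c i) (fun l _ => hc0 i l) (Finset.mem_Icc.2 ⟨hl.1, hl.2.1⟩)
  · have h2 := (h.channelStorage_nonneg_terms hq i).trans (h.channelStorage_le_storage hq i)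
    have hγφ : 0 < B.γ i (q.l i) * φlow i :=
      mul_pos (h.plant.γ_pos i _ (hq i).1.1 (hq i).1.2.1) (h.φlow_pos i)
    have : 0 ≤ B.γ i (q.l i) * φlow i * A.Wq i q ^ 2 := by positivity
    linarith

/-- Initially, the storage function is bounded by a gain of the distance to the target. -/
lemma exists_storage_le_gain_residual : ∃ κ, IsGain κ ∧ ∀ q ∈ P.stateSpace,
    (∀ i, q.vs i = P.gv i q.x) → q.θ = 0 →
    storage A B φ π ρbar ρhat q ≤ κ q.residual := by
  choose κδ hκδ hδ using h.exists_δ_gain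
  choose C hC0 hC using h.exists_weight_bound
  have hκi (i : Fin N) : IsGain fun s => s + ρbar i * κδ i s
      + (C i * A.βhi i s ^ 2 + ρhat i * κδ i s) :=
    (IsGain.id.add ((hκδ i).const_mul (h.ρbar_nonneg i))).add
      (((h.errors.βhi_class i).isGain.sq.const_mul (hC0 i)).add
        ((hκδ i).const_mul (h.ρhat_nonneg i)))
  refine ⟨_, h.plant.βVhi_class.isGain.add (IsGain.sum Finset.univ fun i _ => hκi i),
    fun q hq hvs hθ => ?_⟩
  have hr0 := q.residual_nonneg
  have hδx (i : Fin N) : B.δ i (P.gv i q.x) ≤ κδ i q.residual :=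
    (hδ i q.x).trans ((hκδ i).le_of_le (norm_nonneg _) q.norm_x_le_residual)
  refine add_le_add ((h.plant.V_upper _).trans
    (h.plant.βVhi_class.le_of_le (norm_nonneg _) q.norm_x_le_residual))
    (Finset.sum_le_sum fun i _ => ?_)
  have hτ := clamp_mem hq i
  have hl := (hq i).1
  refine add_le_add (add_le_add (q.η_le_residual i) ?_) ?_
  -- Initially `ṽ = v`, and since `ϖ ≤ 1` the maximum collapses to `δ(v)`. Likewise `θ = 0` leaves
  -- only `e` in the argument of the upper bound on `W`. At later times the distance to the target
  -- controls neither `ṽ` nor `θ`.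
  · rw [hvs i, max_eq_left (mul_le_of_le_one_left (h.δ_nonneg i _) (h.varpi_mem i hτ).2)]
    exact mul_le_mul_of_nonneg_left (hδx i) (h.ρbar_nonneg i)
  · have hW : A.Wq i q ≤ A.βhi i q.residual := by
      refine (h.errors.upper i _ _ _ hl _).trans
        ((h.errors.βhi_class i).le_of_le (Real.sqrt_nonneg _) ?_)
      have : P.errNorm (q.e i) (q.θ i) = ‖q.e i‖ := by
        simp [errNorm, hθ]
      rw [this]
      exact q.norm_e_le_residual i
    have h1 : B.γ i (q.l i) * φ i (q.l i) (min (q.τ i) (P.TM i)) * A.Wq i q ^ 2 ≤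
        C i * A.βhi i q.residual ^ 2 :=
      mul_le_mul (hC i _ hl.1 hl.2.1 _ hτ) (pow_le_pow_left₀ (h.W_nonneg hq i) hW 2)
        (sq_nonneg _) (hC0 i)
    have h2 : 0 ≤ C i * A.βhi i q.residual ^ 2 := mul_nonneg (hC0 i) (sq_nonneg _)
    have h3 := mul_le_mul_of_nonneg_left (hδx i) (h.ρhat_nonneg i)
    have h4 : 0 ≤ ρhat i * κδ i q.residual := mul_nonneg (h.ρhat_nonneg i) ((hκδ i).nonneg hr0)
    exact max_le (by linarith) (by linarith)

/-! ### Jumps -/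

/-- The storage function does not increase at jumps. -/
lemma storage_jump_le {i : Fin N} {q r : P.State} (hr : r ∈ P.stateSpace)
    (hj : r ∈ jumpMap T i q) :
    storage A B φ π ρbar ρhat r ≤ storage A B φ π ρbar ρhat q := by
  obtain ⟨hqi, hj⟩ := hj
  have hq := hqi.1
  have hmin : min (q.τ i) (P.TM i) = q.τ i := min_eq_left hqi.2.2
  have h0 : min 0 (P.TM i) = 0 := min_eq_left (TM_pos i).le
  have hvarpi0 : P.varpi π i 0 = 1 := by simp [varpi]
  have hmem0 : (0 : ℝ) ∈ Icc 0 (P.TM i) := ⟨le_rfl, (TM_pos i).le⟩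
  have hl := (hq i).1
  suffices H : r.x = q.x ∧ (∀ k ≠ i, channelStorage A B φ π ρbar ρhat k r =
      channelStorage A B φ π ρbar ρhat k q) ∧
      channelStorage A B φ π ρbar ρhat i r ≤ channelStorage A B φ π ρbar ρhat i q by
    obtain ⟨hx, hne, hi⟩ := H
    rw [storage, storage, hx]
    refine add_le_add le_rfl (Finset.sum_le_sum fun k _ => ?_)
    rcases eq_or_ne k i with rfl | hk
    · exact hi
    · exact (hne k hk).le
  have hrl := (hr i).1
  rcases hj with ⟨-, -, μ, -, rfl⟩ | ⟨-, -, rfl⟩ | ⟨-, μ, -, rfl⟩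
  · refine ⟨rfl, fun k hk => by simp [channelStorage, ErrorStorage.Wq, hk], ?_⟩
    -- The new state lies in the state space, so `l + 1 ≤ D + 1`; this is the room needed for one
    -- more pending transmission.
    have hlD : q.l i ≤ P.D i := by
      have := hrl.2.1
      simp only [Function.update_self] at this
      omega
    have hl0 := hl.1
    have hg := h.gt_le i q hqi hlD
    have hW := h.errors.transmit i (q.kt i) (q.l i) (q.θ i) hl hlD (q.e i)
    simp only [channelStorage, ErrorStorage.Wq, Function.update_self, h0, hvarpi0, one_mul, hmin,
      max_self] at hg ⊢
    have hW0 := h.W_nonneg hr i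
    simp only [ErrorStorage.Wq, Function.update_self] at hW0
    have hγφ : 0 ≤ B.γ i (q.l i + 1) * φ i (q.l i + 1) 0 :=
      mul_nonneg (h.plant.γ_pos i _ (by omega) (by omega)).le
        (h.φ_pos i (by omega) (by omega) hmem0).le
    have hsq := mul_le_mul_of_nonneg_left (pow_le_pow_left₀ hW0 hW 2) hγφ
    rw [mul_pow, ← mul_assoc] at hsq
    have := max_le_max_right (ρhat i * B.δ i (P.gv i q.x)) hsq
    linarith
  · refine ⟨rfl, fun k hk => by simp [channelStorage, ErrorStorage.Wq, hk], ?_⟩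
    have hg := h.gs_le i q hqi
    simp only [channelStorage, ErrorStorage.Wq, Function.update_self, h0, hvarpi0, one_mul, hmin,
      max_self] at hg ⊢
    linarith
  · refine ⟨rfl, fun k hk => by simp [channelStorage, ErrorStorage.Wq, hk], ?_⟩
    -- An update needs a pending transmission: `l - 1 ≥ 0` because the new state lies in the state
    -- space.
    have hl1 : 1 ≤ q.l i := by
      have := hrl.1
      simp only [Function.update_self] at this
      omega
    have hτ : q.τ i ∈ Icc 0 (P.TM i) := ⟨(hq i).2.1, hqi.2.2⟩
    have hW := h.errors.update i (q.kt i) (q.l i) (q.θ i) hl hl1 (q.e i)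
    have hW0 := h.W_nonneg hr i
    have hWq0 := h.W_nonneg hq i
    simp only [channelStorage, ErrorStorage.Wq, Function.update_self, hmin] at hW0 hWq0 ⊢
    have hγφ : 0 ≤ B.γ i (q.l i) * φ i (q.l i) (q.τ i) :=
      mul_nonneg (h.plant.γ_pos i _ hl.1 hl.2.1).le (h.φ_pos i hl.1 hl.2.1 hτ).le
    have hsq := mul_le_mul (h.update i _ hl1 hl.2.1 _ hτ) (pow_le_pow_left₀ hW0 hW 2)
      (sq_nonneg _) hγφ
    have := max_le_max_right (ρhat i * B.δ i (P.gv i q.x)) hsq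
    linarith

end DesignConditions
end NCS

namespace NCS

variable {N np nc ny nu nw : ℕ} {P : NCS N np nc ny nu nw}

/-! ### Flows -/

/-- The dissipation inequality of one channel, in terms of the values and the derivatives of the
functions involved. -/
lemma channel_dissipation {γ f W L H J δ δs ϖ dδ dW η a δh ρt ρb ρh ε π r ϵ σ m₁ m₂ loss : ℝ}
    (hγ : 0 < γ) (hf : 0 < f) (hW : 0 ≤ W) (hJ : 0 ≤ J) (hδ : 0 ≤ δ) (hδs : 0 ≤ δs)
    (hdδ : dδ ≤ H ^ 2 + J) (hdW : dW ≤ L * W + H)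
    (h₁ : (ϖ * δs ≤ δ ∧ m₁ = dδ) ∨ (δ ≤ ϖ * δs ∧ m₁ = -r * δs))
    (h₂ : (ρh * δ ≤ γ * f * W ^ 2 ∧
        m₂ = γ * (-2 * L * f - γ * (f ^ 2 + 1)) * W ^ 2 + γ * f * (2 * W * dW)) ∨
      (γ * f * W ^ 2 ≤ ρh * δ ∧ m₂ = ρh * dδ))
    (hloss : (δ < ϖ * δs ∧ loss = ε * r * (ρb * δs)) ∨ (ϖ * δs ≤ δ ∧ loss = 0))
    (hρh0 : 0 ≤ ρh) (hρh : ρh ≤ 1 / 2) (hρh' : γ * ρh ≤ f / 2) (hρb : 0 ≤ ρb) (hρbϵ : ρb ≤ ϵ)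
    (hρt : ρt ≤ ρb * r) (hρtπ : ρt ≤ π / 2) (hρt0 : 0 ≤ ρt) (hπ : π ≤ ϖ) (hr : 0 ≤ r)
    (hε0 : 0 ≤ ε) (hε1 : ε ≤ 1) :
    (-a * η + δh + (1 - ε) * ρt * δs) + ρb * m₁ + m₂
      + (γ ^ 2 * W ^ 2 - δ - σ - (1 + ϵ) * H ^ 2 - δh - (1 + ϵ) * J) ≤ -(a * η + σ + loss) := by
  have hHJ : 0 ≤ H ^ 2 + J := by positivity
  -- On the error branch, the Riccati term `-γ(f² + 1)` cancels `γ²W²`, the `L` terms cancel, and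
  -- what is left is `2γfWH - (γfW)² ≤ H²`. On the `δ` branch, `W²` is so small that `γ²W² ≤ δ/2`,
  -- and `ρh ≤ 1/2` absorbs the derivative of `δ`. Either way at most half of the available `δ` is
  -- spent.
  have hstep₂ : γ ^ 2 * W ^ 2 + m₂ ≤ H ^ 2 + J + δ / 2 := by
    rcases h₂ with ⟨-, rfl⟩ | ⟨hle, rfl⟩
    · have h3 := mul_le_mul_of_nonneg_left hdW (by positivity : 0 ≤ γ * f * (2 * W))
      nlinarith [sq_nonneg (γ * f * W - H)]
    · have h3 : γ ^ 2 * W ^ 2 ≤ δ / 2 := by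
        have h4 := mul_le_mul_of_nonneg_left hle hγ.le
        have h5 := mul_le_mul_of_nonneg_right hρh' hδ
        have h6 : f * (γ ^ 2 * W ^ 2) ≤ f * (δ / 2) := by nlinarith
        exact le_of_mul_le_mul_left h6 hf
      have h4 := mul_le_mul_of_nonneg_left hdδ hρh0
      nlinarith
  have hϵHJ := mul_le_mul_of_nonneg_right hρbϵ hHJ
  -- The other half of `δ` is spent here. If `δ(v)` is active, `ρt ≤ π/2` and `π ≤ ϖ` give `ρt δs ≤
  -- δ/2`. If the sampled value is active, the slope of `ϖ` contributes `-ρb r δs`; the fraction `1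
  -- - ε` of it cancels the input to `η`, and the rest covers `loss`.
  have hstep₁ : (1 - ε) * ρt * δs + ρb * m₁ ≤ ϵ * (H ^ 2 + J) + δ / 2 - loss := by
    rcases h₁ with ⟨hle, rfl⟩ | ⟨hle, rfl⟩
    · rcases hloss with ⟨hlt, -⟩ | ⟨-, rfl⟩
      · exact absurd hle (not_le.2 hlt)
      · have h3 := mul_le_mul_of_nonneg_left hdδ hρb
        have h4 := mul_le_mul_of_nonneg_right hρtπ hδs
        have h5 := mul_le_mul_of_nonneg_right hπ hδs
        have h6 : 0 ≤ ε * (ρt * δs) := mul_nonneg hε0 (mul_nonneg hρt0 hδs)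
        linarith
    · have h3 := mul_le_mul_of_nonneg_left (mul_le_mul_of_nonneg_right hρt hδs)
        (sub_nonneg.2 hε1)
      have h4 : 0 ≤ ε * r * (ρb * δs) := by positivity
      have h5 : 0 ≤ ϵ * (H ^ 2 + J) := mul_nonneg (hρb.trans hρbϵ) hHJ
      rcases hloss with ⟨-, rfl⟩ | ⟨-, rfl⟩ <;> linarith
  linarith

namespace DesignConditions

variable {T : P.Trigger} {A : P.ErrorStorage} {B : P.PlantStorage} {φ : Fin N → ℤ → ℝ → ℝ}
  {a ε π ρbar ρhat φlow : Fin N → ℝ} (h : DesignConditions P T A B φ a ε π ρbar ρhat φlow)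
include h

/-- The differential equation bounds the derivative of `φ`, which is continuous on a compact
interval. -/
lemma exists_φ_lipschitz (i : Fin N) {l : ℤ} (h0 : 0 ≤ l) (h1 : l ≤ P.D i + 1) :
    ∃ K, LipschitzOnWith K (φ i l) (Icc 0 (P.TM i)) := by
  have hcont : ContinuousOn (φ i l) (Icc 0 (P.TM i)) := fun τ hτ =>
    (h.φ_ode i l h0 h1 τ hτ).continuousWithinAt
  obtain ⟨C, hC⟩ := isCompact_Icc.exists_bound_of_continuousOn
    (f := fun τ => -2 * A.L i l * φ i l τ - B.γ i l * (φ i l τ ^ 2 + 1)) (s := Icc 0 (P.TM i))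
    (by fun_prop)
  exact ⟨_, (convex_Icc _ _).lipschitzOnWith_of_nnnorm_hasDerivWithin_le (h.φ_ode i l h0 h1)
    fun τ hτ => NNReal.le_toNNReal_of_coe_le (hC τ hτ)⟩

lemma ρhat_le_half (i : Fin N) : ρhat i ≤ 1 / 2 := by
  have := h.ρhat_le i
  have h1 := min_le_left (1 : ℝ) (φlow i / B.γmax i)
  linarith

/-- Tuned so that `γ²W² ≤ δ/2` wherever the `δ` branch dominates `γ φ W²`. -/
lemma γ_mul_ρhat_le (i : Fin N) {l : ℤ} (h0 : 0 ≤ l) (h1 : l ≤ P.D i + 1) :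
    B.γ i l * ρhat i ≤ φlow i / 2 := by
  have hγ := h.plant.γ_pos i l h0 h1
  have hmax : B.γ i l ≤ B.γmax i :=
    Finset.le_sup' (B.γ i) (Finset.mem_Icc.2 ⟨h0, h1⟩)
  have h2 : ρhat i ≤ 1 / 2 * (φlow i / B.γmax i) :=
    (h.ρhat_le i).trans (mul_le_mul_of_nonneg_left (min_le_right _ _) (by norm_num))
  calc B.γ i l * ρhat i ≤ B.γmax i * (1 / 2 * (φlow i / B.γmax i)) :=
        mul_le_mul hmax h2 (h.ρhat_nonneg i) (hγ.le.trans hmax)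
    _ = φlow i / 2 := by
        have : B.γmax i ≠ 0 := (hγ.trans_le hmax).ne'
        field_simp

/-- With `e` and `w` frozen at their values at time `r`, the field `x ↦ f(x, e, w)` is continuous
and agrees with the velocity of the curve at that instant, which is all that the nonsmooth chain
rule needs. -/
lemma deriv_V_le {c : ℝ → P.X} {e : P.Err} {w : P.Dist} {r d : ℝ}
    (hc : HasDerivAt c (P.f (c r) e w) r) (hd : HasDerivAt (fun s => B.V (c s)) d r)
    (k : Fin N → ℕ) (l : Fin N → ℤ) (θ : (i : Fin N) → P.Mem i)
    (hadm : ∀ i, P.Adm i (l i) (θ i)) :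
    d ≤ -B.αV ‖c r‖
      + ∑ i, (B.γ i (l i) ^ 2 * A.W i (k i) (l i) (θ i) (e i) ^ 2
          - B.δ i (P.gv i (c r))
          - B.σ i (l i) (A.W i (k i) (l i) (θ i) (e i))
          - (1 + B.ϵ i (l i)) * A.H i (l i) (c r) e w ^ 2
          - B.δh i (P.gv i (c r) + e i)
          - (1 + B.ϵ i (l i)) * B.J i (c r) e w)
      + B.αw ‖w‖ := by
  refine h.plant.V_lipschitz.deriv_le_of_ae_fderiv_le (F := fun x => P.f x e w)
    (g := fun x => -B.αV ‖x‖
      + ∑ i, (B.γ i (l i) ^ 2 * A.W i (k i) (l i) (θ i) (e i) ^ 2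
          - B.δ i (P.gv i x)
          - B.σ i (l i) (A.W i (k i) (l i) (θ i) (e i))
          - (1 + B.ϵ i (l i)) * A.H i (l i) x e w ^ 2
          - B.δh i (P.gv i x + e i)
          - (1 + B.ϵ i (l i)) * B.J i x e w)
      + B.αw ‖w‖) volume (P.continuous_f_x e w) ?_ ?_ hc hd
  · have hα : Continuous fun x : P.X => B.αV ‖x‖ :=
      h.plant.αV_class.1.1.comp_continuous continuous_norm fun x => norm_nonneg x
    refine (hα.neg.add (continuous_finsetSum _ fun i _ => ?_)).add continuous_const
    have hgv := (P.contDiff_gv i).continuous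
    have h1 := (h.plant.δ_lipschitz i).continuous
    have h2 := (h.plant.δh_lipschitz i).continuous
    have h3 : Continuous fun x => A.H i (l i) x e w :=
      (h.errors.H_cont i _ (hadm i).1 (hadm i).2.1).comp
        (f := fun x : P.X => (x, e, w)) (by fun_prop)
    have h4 : Continuous fun x => B.J i x e w :=
      (h.plant.J_cont i).comp (f := fun x : P.X => (x, e, w)) (by fun_prop)
    fun_prop
  · filter_upwards [h.plant.flow_V] with x hx using hx e w k l θ hadm

lemma deriv_δ_le {c : ℝ → P.X} {e : P.Err} {w : P.Dist} {r d : ℝ}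
    (hc : HasDerivAt c (P.f (c r) e w) r) {i : Fin N}
    (hd : HasDerivAt (fun s => B.δ i (P.gv i (c s))) d r) {l : ℤ} (h0 : 0 ≤ l)
    (h1 : l ≤ P.D i + 1) : d ≤ A.H i l (c r) e w ^ 2 + B.J i (c r) e w := by
  refine (h.plant.locallyLipschitz_δ_gv i).deriv_le_of_ae_fderiv_le (F := fun x => P.f x e w)
    (g := fun x => A.H i l x e w ^ 2 + B.J i x e w) volume (P.continuous_f_x e w) ?_ ?_ hc hd
  · have h3 : Continuous fun x => A.H i l x e w :=
      (h.errors.H_cont i _ h0 h1).comp (f := fun x : P.X => (x, e, w)) (by fun_prop)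
    have h4 : Continuous fun x => B.J i x e w :=
      (h.plant.J_cont i).comp (f := fun x : P.X => (x, e, w)) (by fun_prop)
    fun_prop
  · filter_upwards [h.plant.flow_δ] with x hx using hx e w i l h0 h1

/-- Here `x`, `w` and the errors of the other channels are frozen, so that the inequality for almost
every `e_i` concerns a continuous vector field in `e_i` alone. -/
lemma deriv_W_le {c : ℝ → P.Err} {x : P.X} {w : P.Dist} {r d : ℝ} {i : Fin N}
    (hc : HasDerivAt (fun s => c s i) (-P.fv i x (c r) w) r) {k : ℕ} {l : ℤ} {θ : P.Mem i}
    (hadm : P.Adm i l θ) (hd : HasDerivAt (fun s => A.W i k l θ (c s i)) d r) :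
    d ≤ A.L i l * A.W i k l θ (c r i) + A.H i l x (c r) w := by
  have hWl := h.errors.locallyLipschitz i k hadm
  have hupd : Continuous fun ε : P.Sig i => Function.update (c r) i ε :=
    continuous_const.update i continuous_id
  have := hWl.deriv_le_of_ae_fderiv_le
    (F := fun ε => -P.fv i x (Function.update (c r) i ε) w)
    (g := fun ε => A.L i l * A.W i k l θ ε + A.H i l x (Function.update (c r) i ε) w) volume
    (P.continuous_fv_update i x (c r) w).neg ?_ (h.errors.flow i k l θ hadm x (c r) w)
    (c := fun s => c s i) (by simpa using hc) hd
  · simpa using this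
  · have h3 : Continuous fun ε : P.Sig i => A.H i l x (Function.update (c r) i ε) w :=
      (h.errors.H_cont i _ hadm.1 hadm.2.1).comp
        (f := fun ε : P.Sig i => (x, Function.update (c r) i ε, w)) (by fun_prop)
    have := hWl.continuous
    fun_prop

set_option maxHeartbeats 1000000 in
/-- Along flows, the storage function is absolutely continuous and satisfies the dissipation
inequality. -/
lemma storage_flow {E : Set (ℝ × ℕ)} {q : ℝ → ℕ → P.State} {w : ℝ → ℕ → P.Dist}
    (hsol : IsSolution T E q w) (hw : hybridSupNorm E w ≠ ∞) {j : ℕ} {s t : ℝ} (hst : s < t)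
    (hI : Icc s t ⊆ hybridSlice E j) :
    AbsolutelyContinuousOnInterval (fun r => storage A B φ π ρbar ρhat (q r j)) s t ∧
    ∀ᵐ r, r ∈ Ioo s t → ∀ d, HasDerivAt (fun r => storage A B φ π ρbar ρhat (q r j)) d r →
      d ≤ -dissipation A B a ε π ρbar (q r j) + B.αw (hybridSupNorm E w).toReal := by
  have hs' : s ∈ Icc s t := ⟨le_rfl, hst.le⟩
  have ht' : t ∈ Icc s t := ⟨hst.le, le_rfl⟩
  have huIcc : uIcc s t = Icc s t := uIcc_of_le hst.le
  have hmem (r : ℝ) (hr : r ∈ Icc s t) : q r j ∈ P.stateSpace := hsol.mem r j (hI hr)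
  have hτeq (r : ℝ) (hr : r ∈ Icc s t) (i : Fin N) : (q r j).τ i = (q s j).τ i + (r - s) :=
    hsol.flow_τ j s (hI hs') r (hI hr) i
  have hτmem (r : ℝ) (hr : r ∈ Icc s t) (i : Fin N) :
      (q s j).τ i + (r - s) ∈ Icc 0 (P.TM i) := by
    rw [← hτeq r hr i]
    exact ⟨(hmem r hr i).2.1, hsol.τ_le hst hI hr i⟩
  have hτmin (r : ℝ) (hr : r ∈ Icc s t) (i : Fin N) :
      min ((q r j).τ i) (P.TM i) = (q s j).τ i + (r - s) := by
    rw [min_eq_left (hsol.τ_le hst hI hr i), hτeq r hr i]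
  have hconst (r : ℝ) (hr : r ∈ Icc s t) := hsol.flow_const j s (hI hs') r (hI hr)
  have hadm (i : Fin N) : P.Adm i ((q s j).l i) ((q s j).θ i) := (hmem s hs' i).1
  -- the ingredients of the storage function, with the constant components frozen
  set vx : ℝ → ℝ := fun r => B.V (q r j).x with hvx
  set dl : Fin N → ℝ → ℝ := fun i r => B.δ i (P.gv i (q r j).x) with hdl
  set Wr : Fin N → ℝ → ℝ := fun i r =>
    A.W i ((q s j).kt i) ((q s j).l i) ((q s j).θ i) ((q r j).e i) with hWr
  set vp : Fin N → ℝ → ℝ := fun i r =>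
    P.varpi π i ((q s j).τ i + (r - s)) * B.δ i ((q s j).vs i) with hvp
  set ph : Fin N → ℝ → ℝ := fun i r => φ i ((q s j).l i) ((q s j).τ i + (r - s)) with hph
  set m₁ : Fin N → ℝ → ℝ := fun i r => max (dl i r) (vp i r) with hm₁
  set m₂ : Fin N → ℝ → ℝ := fun i r =>
    max (B.γ i ((q s j).l i) * ph i r * Wr i r ^ 2) (ρhat i * dl i r) with hm₂
  -- On a nondegenerate flow interval no timer exceeds `T_M`, so the clamp is inactive and the
  -- weights are smooth or Lipschitz functions of time.
  have hEq : EqOn (fun r => vx r + ∑ i, ((q r j).η i + ρbar i * m₁ i r + m₂ i r))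
      (fun r => storage A B φ π ρbar ρhat (q r j)) (Icc s t) := by
    intro r hr
    obtain ⟨c1, c2, c3, -, c5, -⟩ := hconst r hr
    simp only [storage, channelStorage, ErrorStorage.Wq, hτmin r hr, c1, c2, c3, c5, hvx, hm₁, hm₂,
      hdl, hvp, hph, hWr]
  have hacx : AbsolutelyContinuousOnInterval (fun r => (q r j).x) s t :=
    hsol.ac_x j s (hI hs') t (hI ht')
  have hac_vx : AbsolutelyContinuousOnInterval vx s t :=
    AbsolutelyContinuousOnInterval.locallyLipschitz_comp h.plant.V_lipschitz hacx
  have hac_dl (i : Fin N) : AbsolutelyContinuousOnInterval (dl i) s t :=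
    AbsolutelyContinuousOnInterval.locallyLipschitz_comp (g := fun x => B.δ i (P.gv i x))
      (h.plant.locallyLipschitz_δ_gv i) hacx
  have hac_W (i : Fin N) : AbsolutelyContinuousOnInterval (Wr i) s t :=
    AbsolutelyContinuousOnInterval.locallyLipschitz_comp
      (h.errors.locallyLipschitz i _ (hadm i)) (hsol.ac_e j i s (hI hs') t (hI ht'))
  have hac_τ (i : Fin N) :
      AbsolutelyContinuousOnInterval (fun r => (q s j).τ i + (r - s)) s t :=
    (by fun_prop : ContDiff ℝ 1 fun r => (q s j).τ i + (r - s)).contDiffOn.absolutelyContinuousOnInterval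
  have hac_vp (i : Fin N) : AbsolutelyContinuousOnInterval (vp i) s t := by
    have : ContDiff ℝ 1 (vp i) := by
      simp only [hvp, varpi]
      fun_prop
    exact this.contDiffOn.absolutelyContinuousOnInterval
  have hac_ph (i : Fin N) : AbsolutelyContinuousOnInterval (ph i) s t := by
    obtain ⟨K, hK⟩ := h.exists_φ_lipschitz i (hadm i).1 (hadm i).2.1
    refine AbsolutelyContinuousOnInterval.lipschitz_comp hK (hac_τ i) fun r hr => ?_
    exact hτmem r (huIcc ▸ hr) i
  have hac_m₁ (i : Fin N) : AbsolutelyContinuousOnInterval (m₁ i) s t := (hac_dl i).sup (hac_vp i)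
  have hac_m₂ (i : Fin N) : AbsolutelyContinuousOnInterval (m₂ i) s t := by
    refine AbsolutelyContinuousOnInterval.sup ?_ ((hac_dl i).const_mul _)
    simp only [sq]
    exact ((hac_ph i).const_mul _).fun_mul ((hac_W i).fun_mul (hac_W i))
  have hac : AbsolutelyContinuousOnInterval
      (fun r => vx r + ∑ i, ((q r j).η i + ρbar i * m₁ i r + m₂ i r)) s t :=
    hac_vx.fun_add (AbsolutelyContinuousOnInterval.finset_sum _ fun i _ =>
      ((hsol.ac_η j i s (hI hs') t (hI ht')).fun_add ((hac_m₁ i).const_mul _)).fun_add (hac_m₂ i))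
  refine ⟨hac.congr (huIcc ▸ hEq), ?_⟩
  have hres {p : ℝ → Prop} (hp : ∀ᵐ r ∂(volume.restrict (hybridSlice E j)), p r) :
      ∀ᵐ r, r ∈ Ioo s t → p r :=
    (ae_restrict_iff' measurableSet_Ioo).1
      (ae_restrict_of_ae_restrict_of_subset (Ioo_subset_Icc_self.trans hI) hp)
  have hint : Ioo s t ⊆ interior (hybridSlice E j) :=
    interior_maximal (Ioo_subset_Icc_self.trans hI) isOpen_Ioo
  -- At almost every time all ingredients and both maxima are differentiable, so the derivative of
  -- the storage can be computed term by term.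
  filter_upwards [hres (hsol.flow_x j), ae_all_iff.2 fun i => hres (hsol.flow_e j i),
    ae_all_iff.2 fun i => hres (hsol.flow_η j i), hres (hybridSupNorm_ae_le hw j),
    hac_vx.ae_differentiableAt, ae_all_iff.2 fun i => (hac_dl i).ae_differentiableAt,
    ae_all_iff.2 fun i => (hac_W i).ae_differentiableAt,
    ae_all_iff.2 fun i => (hac_m₁ i).ae_differentiableAt,
    ae_all_iff.2 fun i => (hac_m₂ i).ae_differentiableAt]
    with r hx he hη hwr hdvx hddl hdW hdm₁ hdm₂ hr d hd
  have hrI : r ∈ Icc s t := Ioo_subset_Icc_self hr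
  have hru : r ∈ uIcc s t := huIcc ▸ hrI
  have hq := hmem r hrI
  obtain ⟨c1, c2, c3, -, c5, -⟩ := hconst r hrI
  have hd' : HasDerivAt (fun r => vx r + ∑ i, ((q r j).η i + ρbar i * m₁ i r + m₂ i r))
      (deriv vx r + ∑ i, (T.fη i (q r j) + ρbar i * deriv (m₁ i) r + deriv (m₂ i) r)) r :=
    (hdvx hru).hasDerivAt.fun_add (HasDerivAt.fun_sum fun i _ =>
      ((hη i hr).fun_add ((hdm₁ i hru).hasDerivAt.const_mul _)).fun_add (hdm₂ i hru).hasDerivAt)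
  have hd_eq : d = deriv vx r + ∑ i, (T.fη i (q r j) + ρbar i * deriv (m₁ i) r + deriv (m₂ i) r) :=
    hd.unique (hd'.congr_of_eventuallyEq
      (by filter_upwards [Icc_mem_nhds hr.1 hr.2] with y hy using (hEq hy).symm))
  have hV := h.deriv_V_le (hx hr) (hdvx hru).hasDerivAt (q s j).kt (q s j).l (q s j).θ hadm
  have hαw := h.plant.αw_class.le_of_le (norm_nonneg _) (hwr hr)
  have hchan (i : Fin N) : (T.fη i (q r j) + ρbar i * deriv (m₁ i) r + deriv (m₂ i) r)
      + (B.γ i ((q s j).l i) ^ 2 * Wr i r ^ 2 - dl i r - B.σ i ((q s j).l i) (Wr i r)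
        - (1 + B.ϵ i ((q s j).l i)) * A.H i ((q s j).l i) (q r j).x (q r j).e (w r j) ^ 2
        - B.δh i (P.gv i (q r j).x + (q r j).e i)
        - (1 + B.ϵ i ((q s j).l i)) * B.J i (q r j).x (q r j).e (w r j)) ≤
      -(a i * (q r j).η i + B.σ i ((q r j).l i) (A.Wq i (q r j))
        + sampleLoss B ε π ρbar i (q r j)) := by
    have hl := hadm i
    have hγ := h.plant.γ_pos i _ hl.1 hl.2.1
    have hWq : A.Wq i (q r j) = Wr i r := by simp only [ErrorStorage.Wq, c1, c3, c5, hWr]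
    have hW0 : 0 ≤ Wr i r := hWq ▸ h.W_nonneg hq i
    have hτr := hτmem r hrI i
    -- At an interior time the timer is interior to `[0, T_M]`, so the derivative of `φ` within the
    -- interval is an ordinary one.
    have hτIoo : Icc 0 (P.TM i) ∈ 𝓝 ((q s j).τ i + (r - s)) := by
      refine Icc_mem_nhds ?_ ?_
      · linarith [hr.1, (hmem s hs' i).2.1]
      · linarith [hr.2, (hτmem t ht' i).2]
    have hTM := TM_pos (P := P) i
    have hτd : HasDerivAt (fun r => (q s j).τ i + (r - s)) 1 r :=
      ((hasDerivAt_id r).sub_const s).const_add _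
    have hphd : HasDerivAt (ph i) (-2 * A.L i ((q s j).l i) * ph i r
        - B.γ i ((q s j).l i) * (ph i r ^ 2 + 1)) r := by
      have h1 := (h.φ_ode i _ hl.1 hl.2.1 _ hτr).hasDerivAt hτIoo
      have h2 := h1.comp r hτd
      rw [mul_one] at h2
      exact h2
    have hvpd : HasDerivAt (vp i) (-((1 - π i) / P.TM i) * B.δ i ((q s j).vs i)) r := by
      have h1 := ((hτd.const_mul ((1 - π i) / P.TM i)).const_sub 1).mul_const
        (B.δ i ((q s j).vs i))
      rw [mul_one] at h1
      exact h1
    have hW2 : HasDerivAt (fun r => B.γ i ((q s j).l i) * ph i r * Wr i r ^ 2)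
        (B.γ i ((q s j).l i) * (-2 * A.L i ((q s j).l i) * ph i r
          - B.γ i ((q s j).l i) * (ph i r ^ 2 + 1)) * Wr i r ^ 2
          + B.γ i ((q s j).l i) * ph i r * (2 * Wr i r * deriv (Wr i) r)) r := by
      have h1 := (hphd.const_mul (B.γ i ((q s j).l i))).mul ((hdW i hru).hasDerivAt.pow 2)
      refine h1.congr_deriv ?_
      simp
    have hδd := (hddl i hru).hasDerivAt
    have hfη := h.fη_le i (q r j) (hsol.flow_mem j r (hint hr))
    rw [c2] at hfη
    have hloss : (dl i r < P.varpi π i ((q s j).τ i + (r - s)) * B.δ i ((q s j).vs i) ∧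
        sampleLoss B ε π ρbar i (q r j) =
          ε i * ((1 - π i) / P.TM i) * (ρbar i * B.δ i ((q s j).vs i))) ∨
        (P.varpi π i ((q s j).τ i + (r - s)) * B.δ i ((q s j).vs i) ≤ dl i r ∧
          sampleLoss B ε π ρbar i (q r j) = 0) := by
      rw [sampleLoss, hτmin r hrI i, c2]
      by_cases hlt : dl i r < P.varpi π i ((q s j).τ i + (r - s)) * B.δ i ((q s j).vs i)
      · exact .inl ⟨hlt, if_pos hlt⟩
      · exact .inr ⟨not_lt.1 hlt, if_neg hlt⟩
    have hrate : 0 ≤ (1 - π i) / P.TM i := div_nonneg (by linarith [(h.π_mem i).2]) hTM.le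
    have hρt : P.rhoTilde π ρbar i ≤ ρbar i * ((1 - π i) / P.TM i) :=
      (min_le_left _ _).trans_eq (mul_div_assoc _ _ _)
    have hρt0 : 0 ≤ P.rhoTilde π ρbar i :=
      le_min (div_nonneg (mul_nonneg (h.ρbar_nonneg i) (by linarith [(h.π_mem i).2])) hTM.le)
        (by linarith [(h.π_mem i).1])
    have hφl := h.φlow_le i _ hl.1 hl.2.1 _ hτr
    have := channel_dissipation (a := a i) (η := (q r j).η i) (ϵ := B.ϵ i ((q s j).l i))
      (δh := B.δh i (P.gv i (q r j).x + (q r j).e i)) (σ := B.σ i ((q s j).l i) (Wr i r))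
      hγ (h.φ_pos i hl.1 hl.2.1 hτr) hW0
      (h.plant.J_nonneg i (q r j).x (q r j).e (w r j)) (h.δ_nonneg i (P.gv i (q r j).x))
      (h.δ_nonneg i ((q s j).vs i)) (h.deriv_δ_le (hx hr) hδd hl.1 hl.2.1)
      (h.deriv_W_le (c := fun r => (q r j).e) (he i hr) hl (hdW i hru).hasDerivAt)
      (hδd.max_cases hvpd (hdm₁ i hru).hasDerivAt)
      (hW2.max_cases (hδd.const_mul (ρhat i)) (hdm₂ i hru).hasDerivAt) hloss
      (h.ρhat_nonneg i) (h.ρhat_le_half i)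
      ((h.γ_mul_ρhat_le i hl.1 hl.2.1).trans (div_le_div_of_nonneg_right hφl zero_le_two))
      (h.ρbar_nonneg i) (h.ρbar_le i _ hl.1 hl.2.1) hρt (min_le_right _ _) hρt0
      (h.varpi_mem i hτr).1 hrate (h.ε_mem i).1.le (h.ε_mem i).2.le
    rw [hWq, c5]
    simp only [hdl] at this ⊢
    linarith
  have hsum := Finset.sum_le_sum fun i (_ : i ∈ Finset.univ) => hchan i
  rw [Finset.sum_add_distrib, Finset.sum_neg_distrib] at hsum
  rw [hd_eq, dissipation]
  linarith

/-! ### From the dissipation inequality to the stability estimate -/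

/-- The set `𝒮` is input-to-state stable. -/
theorem inputToStateStable : InputToStateStable T P.target := by
  obtain ⟨κD, hκD, hUD⟩ := h.exists_storage_le_gain_dissipation
  obtain ⟨κ₁, hκ₁, hU₁⟩ := h.exists_residual_le_gain_storage
  obtain ⟨κ₂, hκ₂, hU₂⟩ := h.exists_storage_le_gain_residual
  -- A gain need not be strictly increasing or unbounded; adding the identity makes it invertible.
  -- The inverse `α` satisfies `α(U) ≤ D`.
  have hκ := IsClassKInf.id.add_gain hκD
  obtain ⟨α, hα, hακ, hκα⟩ := hκ.exists_inverse
  -- Only half of `α` is kept as decay rate; the other half absorbs the disturbance above `lev`,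
  -- which is the level where `α` equals `2ν`.
  obtain ⟨ρ, ρ', hρ, hρ'c, hρ'⟩ := (hα.const_mul (by norm_num : (0 : ℝ) < 1 / 2)).exists_rescaling
  obtain ⟨ρinv, hρinv, hρl, -⟩ := hρ.exists_inverse
  have hF := (IsClassKInf.id.add_gain hκ₁).comp hρinv
  set C : ℝ := ∑ i, 2 / P.Tm i with hC
  set K : ℝ := ∑ i, (2 / P.Tm i * P.TM i + P.D i + 1) with hK
  have hC0 : 0 ≤ C := Finset.sum_nonneg fun i _ => div_nonneg zero_le_two (P.Tm_pos i).le
  -- From `j ≤ C t + K` follows `t + j ≤ (1 + C) t + K`, so `exp (-t) ≤ exp (c K) exp (-c (t + j))`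
  -- with this `c`.
  set c : ℝ := (1 + C)⁻¹ with hc
  have hc0 : 0 < c := by positivity
  have hG := (hρ.comp (IsClassKInf.id.add_gain hκ₂)).const_mul
    (by positivity : 0 < 2 * Real.exp (c * K))
  have hψ := hF.comp ((hρ.comp (hκ.comp
    (h.plant.αw_class.const_mul (by norm_num : (0 : ℝ) < 2)))).const_mul
      (by norm_num : (0 : ℝ) < 2))
  refine ⟨_, _, hF.isClassKL_exp hG hc0, hψ, fun E q w hsol hw hvs hθ t j hp => ?_⟩
  have hq0 : q 0 0 ∈ P.stateSpace := hsol.mem 0 0 hsol.domain.zero_mem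
  have hqt : q t j ∈ P.stateSpace := hsol.mem t j hp
  rw [distTo_target hqt, distTo_target hq0]
  set ν := B.αw (hybridSupNorm E w).toReal with hν
  have hν0 : 0 ≤ ν := h.plant.αw_class.nonneg ENNReal.toReal_nonneg
  set U : P.State → ℝ := storage A B φ π ρbar ρhat with hU
  set lev : ℝ := 2 * ν + κD (2 * ν) with hlev
  have hlev0 : 0 ≤ lev := hκ.nonneg (by linarith)
  have hαlev : α lev = 2 * ν := hακ _ (by linarith)
  have hαD {p : P.State} (hmem : p ∈ P.stateSpace) :
      α (U p) ≤ dissipation A B a ε π ρbar p := by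
    have hD0 := h.dissipation_nonneg hmem
    rw [← hακ _ hD0]
    refine hα.le_of_le (h.storage_nonneg hmem) ((hUD p hmem).trans ?_)
    linarith
  -- The excess over the level is propagated through flows by the exponential estimate and through
  -- jumps by monotonicity. The level `b` lies strictly above `lev`, since `lev` may be zero and the
  -- flow estimate needs a positive cutoff.
  have hdecay (b : ℝ) (hb : lev < b) :
      Real.exp t * (ρ (max (U (q t j)) b) - ρ b) ≤ ρ (max (U (q 0 0)) b) - ρ b := by
    have hb0 : 0 < b := hlev0.trans_lt hb
    refine hsol.domain.induction (C := fun t j =>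
      Real.exp t * (ρ (max (U (q t j)) b) - ρ b) ≤ ρ (max (U (q 0 0)) b) - ρ b)
      (by simp) ?_ ?_ hp
    · intro j s t hst hI hs
      rcases hst.eq_or_lt with rfl | hlt
      · exact hs
      obtain ⟨hac, hder⟩ := h.storage_flow hsol hw hlt hI
      refine le_trans (exp_mul_rescaling_sub_le hρ hρ'c hρ' hb0 hst hac ?_) hs
      filter_upwards [hder] with r hr hrI d hd hbr
      have h1 := hr hrI d hd
      have h2 := hαD (hsol.mem r j (hI (Ioo_subset_Icc_self hrI)))
      have h3 := hα.le_of_le hlev0 (hb.trans hbr).le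
      simp only [hU] at h2
      linarith
    · intro t j h1 h2 hs
      obtain ⟨i, hi⟩ := hsol.jump t j h1 h2
      have hle := h.storage_jump_le (hsol.mem t (j + 1) h2) hi
      refine le_trans (mul_le_mul_of_nonneg_left (sub_le_sub_right (hρ.le_of_le
        (hb0.le.trans (le_max_right _ _)) (max_le_max_right b hle)) _) (Real.exp_pos _).le) hs
  have hUt := h.storage_nonneg hqt
  have hU0 := h.storage_nonneg hq0
  have hbound (b : ℝ) (hb : lev < b) :
      ρ (U (q t j)) ≤ ρ b + Real.exp (-t) * ρ (U (q 0 0)) := by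
    have hb0 : 0 < b := hlev0.trans_lt hb
    have h1 := mul_le_mul_of_nonneg_left (hdecay b hb) (Real.exp_pos (-t)).le
    rw [← mul_assoc, ← Real.exp_add, neg_add_cancel, Real.exp_zero, one_mul] at h1
    have h2 : ρ (U (q t j)) ≤ ρ (max (U (q t j)) b) := hρ.le_of_le hUt (le_max_left _ _)
    have h3 : ρ (max (U (q 0 0)) b) - ρ b ≤ ρ (U (q 0 0)) := by
      rcases le_total (U (q 0 0)) b with hle | hle
      · rw [max_eq_right hle, sub_self]; exact hρ.nonneg hU0
      · rw [max_eq_left hle]; linarith [hρ.nonneg hb0.le]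
    have h4 := mul_le_mul_of_nonneg_left h3 (Real.exp_pos (-t)).le
    linarith
  -- Let `b` decrease to `lev`; `ρ` is continuous up to zero.
  have hbound' : ρ (U (q t j)) ≤ ρ lev + Real.exp (-t) * ρ (U (q 0 0)) := by
    have hlim : Tendsto ρ (𝓝[>] lev) (𝓝 (ρ lev)) :=
      ((hρ.1.1 lev hlev0).mono (fun b hb => hlev0.trans (le_of_lt hb))).tendsto
    exact ge_of_tendsto (hlim.add_const _) (by
      filter_upwards [self_mem_nhdsWithin] with b hb using hbound b hb)
  have ht0 : 0 ≤ t := hsol.domain.2.1 _ hp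
  have hexp : Real.exp (-t) ≤ Real.exp (c * K) * Real.exp (-(c * (t + j))) := by
    rw [← Real.exp_add]
    refine Real.exp_le_exp.2 ?_
    have hj := hsol.jumps_le hp
    rw [← hC, ← hK] at hj
    have h1 : c * (t + j) ≤ c * ((1 + C) * t + K) :=
      mul_le_mul_of_nonneg_left (by linarith) hc0.le
    have h2 : c * ((1 + C) * t + K) = t + c * K := by
      rw [mul_add, ← mul_assoc, hc, inv_mul_cancel₀ (by positivity), one_mul]
    linarith
  have hρU0 : ρ (U (q 0 0)) ≤ ρ ((q 0 0).residual + κ₂ (q 0 0).residual) :=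
    hρ.le_of_le hU0 ((hU₂ _ hq0 hvs hθ).trans
      (le_add_of_nonneg_left (State.residual_nonneg _)))
  have hprod : Real.exp (-t) * ρ (U (q 0 0)) ≤
      Real.exp (c * K) * Real.exp (-(c * (t + j))) *
        ρ ((q 0 0).residual + κ₂ (q 0 0).residual) :=
    mul_le_mul hexp hρU0 (hρ.nonneg hU0) (by positivity)
  set X := Real.exp (-t) * ρ (U (q 0 0)) with hX
  have hX0 : 0 ≤ X := mul_nonneg (Real.exp_pos _).le (hρ.nonneg hU0)
  have hρlev := hρ.nonneg hlev0
  calc (q t j).residual ≤ κ₁ (U (q t j)) := hU₁ _ hqt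
    _ ≤ U (q t j) + κ₁ (U (q t j)) := le_add_of_nonneg_left hUt
    _ = ρinv (ρ (U (q t j))) + κ₁ (ρinv (ρ (U (q t j)))) := by rw [hρl _ hUt]
    _ ≤ ρinv (X + ρ lev) + κ₁ (ρinv (X + ρ lev)) :=
        hF.le_of_le (hρ.nonneg hUt) (by linarith)
    _ ≤ (ρinv (2 * X) + κ₁ (ρinv (2 * X))) + (ρinv (2 * ρ lev) + κ₁ (ρinv (2 * ρ lev))) :=
        hF.isGain.add_le hX0 hρlev
    _ ≤ _ := by
        refine add_le_add (hF.le_of_le (by linarith) ?_) le_rfl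
        calc 2 * X ≤ 2 * (Real.exp (c * K) * Real.exp (-(c * (t + j))) *
              ρ ((q 0 0).residual + κ₂ (q 0 0).residual)) := by linarith
          _ = Real.exp (-(c * (t + j))) * (2 * Real.exp (c * K) *
              ρ ((q 0 0).residual + κ₂ (q 0 0).residual)) := by ring

end DesignConditions
end NCS

end

theorem theorem1 {N np nc ny nu nw : ℕ} (P : NCS N np nc ny nu nw) (T : P.Trigger)
    (A : P.ErrorStorage) (B : P.PlantStorage)
    (hA : NCS.ErrorStorage.Valid P A) (hB : NCS.PlantStorage.Valid P A B)
    -- the functions `φ_{l,i}` on `[0, T_M^i]`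
    (φ : Fin N → ℤ → ℝ → ℝ)
    (hφ_ode : ∀ (i : Fin N) (l : ℤ), 0 ≤ l → l ≤ P.D i + 1 → ∀ τ ∈ Set.Icc 0 (P.TM i),
      HasDerivWithinAt (φ i l)
        (-2 * A.L i l * φ i l τ - B.γ i l * (φ i l τ ^ 2 + 1)) (Set.Icc 0 (P.TM i)) τ)
    (hφ_init : ∀ (i : Fin N) (l : ℤ), 0 ≤ l → l ≤ P.D i + 1 → 0 < φ i l 0)
    -- network setup
    (hTransmit : ∀ (i : Fin N) (l : ℤ), 0 ≤ l → l ≤ P.D i →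
      A.lam i ^ 2 * B.γ i (l + 1) * φ i (l + 1) 0 ≤ B.γ i l * φ i l (P.TM i))
    (hUpdate : ∀ (i : Fin N) (l : ℤ), 1 ≤ l → l ≤ P.D i + 1 → ∀ τ ∈ Set.Icc 0 (P.TM i),
      B.γ i (l - 1) * φ i (l - 1) τ ≤ B.γ i l * φ i l τ)
    -- constants
    (a ε π ρbar ρhat φlow : Fin N → ℝ)
    (ha : ∀ i, 0 < a i) (hε : ∀ i, ε i ∈ Set.Ioo 0 1) (hπ : ∀ i, π i ∈ Set.Ioo 0 1)
    (hφlow_pos : ∀ i, 0 < φlow i)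
    (hφlow : ∀ (i : Fin N) (l : ℤ), 0 ≤ l → l ≤ P.D i + 1 → ∀ τ ∈ Set.Icc 0 (P.TM i), φlow i ≤ φ i l τ)
    (hρbar_nonneg : ∀ i, 0 ≤ ρbar i) (hρhat_nonneg : ∀ i, 0 ≤ ρhat i)
    (hρbar : ∀ (i : Fin N) (l : ℤ), 0 ≤ l → l ≤ P.D i + 1 → ρbar i ≤ B.ϵ i l)
    (hρhat : ∀ i, ρhat i ≤ 1 / 2 * min 1 (φlow i / B.γmax i))
    -- dynamics of `η_i`
    (hfη : ∀ i, ∀ q ∈ P.flowSet,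
      T.fη i q ≤ -a i * q.η i + B.δh i (P.gv i q.x + q.e i)
        + (1 - ε i) * P.rhoTilde π ρbar i * B.δ i (q.vs i))
    (hgt : ∀ i, ∀ q ∈ P.jumpSet i, q.l i ≤ P.D i →
      T.gt i q ≤ q.η i - ρbar i * B.δ i (P.gv i q.x)
        + ρbar i * max (B.δ i (P.gv i q.x)) (P.varpi π i (q.τ i) * B.δ i (q.vs i))
        - max (B.γ i (q.l i + 1) * φ i (q.l i + 1) 0 * A.lam i ^ 2 * A.Wq i q ^ 2)
            (ρhat i * B.δ i (P.gv i q.x))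
        + max (B.γ i (q.l i) * φ i (q.l i) (q.τ i) * A.Wq i q ^ 2)
            (ρhat i * B.δ i (P.gv i q.x)))
    (hgs : ∀ i, ∀ q ∈ P.jumpSet i,
      T.gs i q ≤ q.η i - ρbar i * B.δ i (P.gv i q.x)
        + ρbar i * max (B.δ i (P.gv i q.x)) (P.varpi π i (q.τ i) * B.δ i (q.vs i))
        - max (B.γ i (q.l i) * φ i (q.l i) 0 * A.Wq i q ^ 2) (ρhat i * B.δ i (P.gv i q.x))
        + max (B.γ i (q.l i) * φ i (q.l i) (q.τ i) * A.Wq i q ^ 2)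
            (ρhat i * B.δ i (P.gv i q.x))) :
    NCS.InputToStateStable T P.target :=
  NCS.DesignConditions.inputToStateStable
    ⟨hA, hB, hφ_ode, hUpdate, ha, hε, hπ, hφlow_pos, hφlow, hρbar_nonneg, hρhat_nonneg, hρbar, hρhat,
      hfη, hgt, hgs⟩
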